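/- Let $X$ be a (real or complex) Hilbert space and let $A$, with domain $D(A)$, be the infinitesimal generator of a $C_0$-semigroup of contractions $(S(t))_{t\ge 0}$ on $X$. Fix $\mu$ in the resolvent set of $A$, let $X_{-1}$ be the completion of $X$ for the norm $\|x\|_{-1}=\|(\mu I-A)^{-1}x\|$, let $i:X\to X_{-1}$ be the canonical injection (often omitted from the notation), let $A_{-1}\in\mathcal L(X,X_{-1})$ be the bounded extension of $A$, and let $S_{-1}(t)$ be the bounded extension of $S(t)$ to $X_{-1}$. For $C\in\mathcal L(X,X_{-1})$ let $C|_X$ denote the part of $C$ in $X$, that is, $D(C|_X)=\{x\in X: Cx\in X\}$ and $C|_Xx=Cx$. Let $B\in\mathcal L(X,X_{-1})$ be $p$-admissible for some $1<p<\infty$: there is $T_0>0$ such that $\int_0^{T_0}S_{-1}(T_0-s)Bu(s)\,ds\in X$ for all $u\in L^p(0,T_0;X)$. Let $\mathfrak X=i(X)$ and let $\mathfrak X_{-1}$ be a linear subspace of $X_{-1}$ (not necessarily closed) with $\mathfrak X\cap\mathfrak X_{-1}=\{0\}$. For $C\in\mathcal L(X,X_{-1})$ with range in $\mathfrak X\oplus\mathfrak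 X_{-1}$ put ${}_XC=P_{\mathfrak X}C$, where $P_{\mathfrak X}$ is the projection of $\mathfrak X\oplus\mathfrak X_{-1}$ onto $\mathfrak X\cong X$ along $\mathfrak X_{-1}$. Suppose that there is $\rho_0>0$ such that for every $\rho\in(0,\rho_0)$ the decomposition is admissible for the pair $(A_{-1},-\rho B)$, i.e.: (a) the ranges of $A_{-1}$ and of $-\rho B$ are contained in $\mathfrak X\oplus\mathfrak X_{-1}$; (b) ${}_X(A_{-1})$ is dissipative on $D((A_{-1}-\rho B)|_X)$, i.e. $\mathrm{Re}\,\langle {}_X(A_{-1})x,x\rangle\le 0$ for all $x$ in that domain; (c) ${}_X(-\rho B)$ is a bounded operator on $X$. Suppose moreover that for some $T,\delta>0$ $$\int_0^T \mathrm{Re}\,\langle {}_XB\,S(t)x,S(t)x\rangle\,dt\ \ge\ \delta\|S(T)x\|^2\qquad\text{for all }x\in X.$$ Then there is $\rho_1>0$ such that for every $\rho\in(0,\rho_1)$ the system $\dot x(t)=Ax(t)-\rho Bx(t)$, $x(0)=x_0$, is exponentially stable on $X$: the operator $(A_{-1}-\rho B)|_X$ generates a $C_0$-semigroup $(U(t))_{t\ge0}$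 on $X$; for each $x_0\in X$ the function $x(t)=U(t)x_0$ is the unique global mild solution, i.e. the unique continuous $x:[0,\infty)\to X$ with $$x(t)=S(t)x_0-\rho\int_0^tS_{-1}(t-s)Bx(s)\,ds\quad(t\ge0);$$ and there are $K,\sigma>0$ with $\|U(t)x_0\|\le Ke^{-\sigma t}\|x_0\|$ for all $t\ge0$ and $x_0\in X$. -/

import Mathlib

open Filter Topology MeasureTheory

noncomputable section

namespace RangeDecomposition

section Semigroups

variable {𝕜 X : Type*} [RCLike 𝕜] [NormedAddCommGroup X] [NormedSpace 𝕜 X]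

variable (𝕜 X) in
/-- A strongly continuous semigroup of bounded operators on `X`. Only the values at times `t ≥ 0`
carry information. -/
structure C0Semigroup where
  /-- the operator at time `t` -/
  op : ℝ → X →L[𝕜] X
  op_zero : op 0 = ContinuousLinearMap.id 𝕜 X
  op_add : ∀ s t : ℝ, 0 ≤ s → 0 ≤ t → op (s + t) = (op s).comp (op t)
  tendsto_zero : ∀ x : X, Tendsto (fun t : ℝ => op t x) (𝓝[>] 0) (𝓝 x)

/-- `A` is the infinitesimal generator of `S`: its graph consists of all pairs `(x, y)` such that
`(S h x - x) / h → y` as `h → 0+`. -/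
def C0Semigroup.IsGeneratedBy (S : C0Semigroup 𝕜 X) (A : X →ₗ.[𝕜] X) : Prop :=
  ∀ x y : X, (x, y) ∈ A.graph ↔
    Tendsto (fun h : ℝ => ((h : 𝕜)⁻¹) • (S.op h x - x)) (𝓝[>] 0) (𝓝 y)

/-- A semigroup of contractions. -/
def C0Semigroup.IsContractive (S : C0Semigroup 𝕜 X) : Prop :=
  ∀ t : ℝ, 0 ≤ t → ‖S.op t‖ ≤ 1

/-- `R` is a bounded two-sided inverse of `μ I - A : D(A) → X`. -/
def IsResolventAt (A : X →ₗ.[𝕜] X) (μ : 𝕜) (R : X →L[𝕜] X) : Prop :=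
  (∀ x : A.domain, R (μ • (x : X) - A x) = x) ∧
    ∀ x : X, ∃ h : R x ∈ A.domain, μ • R x - A ⟨R x, h⟩ = x

/-- The resolvent set of an unbounded operator. -/
def resolventSet (A : X →ₗ.[𝕜] X) : Set 𝕜 :=
  {μ | ∃ R : X →L[𝕜] X, IsResolventAt A μ R}

open Classical in
/-- The resolvent `(μ I - A)⁻¹`, for `μ` in the resolvent set (and `0` elsewhere). -/
def resolvent (A : X →ₗ.[𝕜] X) (μ : 𝕜) : X →L[𝕜] X :=
  if h : ∃ R : X →L[𝕜] X, IsResolventAt A μ R then h.choose else 0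

theorem isResolventAt_resolvent {A : X →ₗ.[𝕜] X} {μ : 𝕜} (hμ : μ ∈ resolventSet A) :
    IsResolventAt A μ (resolvent A μ) := by
  have h : ∃ R : X →L[𝕜] X, IsResolventAt A μ R := hμ
  rw [resolvent, dif_pos h]
  exact h.choose_spec

theorem resolvent_injective {A : X →ₗ.[𝕜] X} {μ : 𝕜} (hμ : μ ∈ resolventSet A) :
    Function.Injective (resolvent A μ) := by
  refine (injective_iff_map_eq_zero _).2 fun x hx => ?_
  obtain ⟨h, hx'⟩ := (isResolventAt_resolvent hμ).2 x
  have h0 : (⟨resolvent A μ x, h⟩ : A.domain) = 0 := Subtype.ext hx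
  rw [h0, hx] at hx'
  simpa using hx'.symm

end Semigroups

section Extrapolation

variable {𝕜 X : Type*} [RCLike 𝕜] [NormedAddCommGroup X] [NormedSpace 𝕜 X]

/-- A copy of `X`, to be equipped with the norm `‖x‖₋₁ = ‖(μ I - A)⁻¹ x‖`. -/
def PreExtrap (_A : X →ₗ.[𝕜] X) (_μ : 𝕜) : Type _ := X

instance (A : X →ₗ.[𝕜] X) (μ : 𝕜) : AddCommGroup (PreExtrap A μ) :=
  inferInstanceAs (AddCommGroup X)

instance (A : X →ₗ.[𝕜] X) (μ : 𝕜) : Module 𝕜 (PreExtrap A μ) :=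
  inferInstanceAs (Module 𝕜 X)

/-- The identity map from `X` to its copy. -/
def toPre (A : X →ₗ.[𝕜] X) (μ : 𝕜) : X ≃ₗ[𝕜] PreExtrap A μ :=
  LinearEquiv.refl 𝕜 X

/-- The resolvent as a linear map on the copy of `X`. -/
def preResolvent (A : X →ₗ.[𝕜] X) (μ : 𝕜) : PreExtrap A μ →ₗ[𝕜] X :=
  (resolvent A μ).toLinearMap ∘ₗ (toPre A μ).symm.toLinearMap

instance (A : X →ₗ.[𝕜] X) (μ : 𝕜) : SeminormedAddCommGroup (PreExtrap A μ) :=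
  SeminormedAddCommGroup.induced (PreExtrap A μ) X (preResolvent A μ)

instance (A : X →ₗ.[𝕜] X) (μ : 𝕜) : NormedSpace 𝕜 (PreExtrap A μ) :=
  NormedSpace.induced 𝕜 (PreExtrap A μ) X (preResolvent A μ)

theorem norm_toPre (A : X →ₗ.[𝕜] X) (μ : 𝕜) (x : X) :
    ‖toPre A μ x‖ = ‖resolvent A μ x‖ := rfl

/-- The extrapolation space `X₋₁`: the completion of `X` for the norm
`‖x‖₋₁ = ‖(μ I - A)⁻¹ x‖`. -/
def Extrap (A : X →ₗ.[𝕜] X) (μ : 𝕜) : Type _ :=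
  UniformSpace.Completion (PreExtrap A μ)

instance (A : X →ₗ.[𝕜] X) (μ : 𝕜) : NormedAddCommGroup (Extrap A μ) :=
  inferInstanceAs (NormedAddCommGroup (UniformSpace.Completion (PreExtrap A μ)))

instance (A : X →ₗ.[𝕜] X) (μ : 𝕜) : NormedSpace 𝕜 (Extrap A μ) :=
  inferInstanceAs (NormedSpace 𝕜 (UniformSpace.Completion (PreExtrap A μ)))

instance (A : X →ₗ.[𝕜] X) (μ : 𝕜) : CompleteSpace (Extrap A μ) :=
  inferInstanceAs (CompleteSpace (UniformSpace.Completion (PreExtrap A μ)))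

instance (A : X →ₗ.[𝕜] X) (μ : 𝕜) : NormedSpace ℝ (Extrap A μ) :=
  NormedSpace.restrictScalars ℝ 𝕜 (Extrap A μ)

instance (A : X →ₗ.[𝕜] X) (μ : 𝕜) : IsScalarTower ℝ 𝕜 (Extrap A μ) :=
  ⟨fun r c z => by
    rw [Algebra.smul_def, mul_smul]
    rfl⟩

/-- The canonical injection `i : X → X₋₁`. -/
def incl (A : X →ₗ.[𝕜] X) (μ : 𝕜) : X →L[𝕜] Extrap A μ :=
  LinearMap.mkContinuous
    ((UniformSpace.Completion.toComplₗᵢ :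
        PreExtrap A μ →ₗᵢ[𝕜] UniformSpace.Completion (PreExtrap A μ)).toLinearMap ∘ₗ
      (toPre A μ).toLinearMap)
    ‖resolvent A μ‖
    (fun x => by
      change ‖((toPre A μ x : PreExtrap A μ) : UniformSpace.Completion (PreExtrap A μ))‖ ≤ _
      rw [UniformSpace.Completion.norm_coe, norm_toPre]
      exact (resolvent A μ).le_opNorm x)

theorem norm_incl (A : X →ₗ.[𝕜] X) (μ : 𝕜) (x : X) :
    ‖incl A μ x‖ = ‖resolvent A μ x‖ := by
  change ‖((toPre A μ x : PreExtrap A μ) : UniformSpace.Completion (PreExtrap A μ))‖ = _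
  rw [UniformSpace.Completion.norm_coe, norm_toPre]

theorem denseRange_incl (A : X →ₗ.[𝕜] X) (μ : 𝕜) : DenseRange (incl A μ) :=
  (UniformSpace.Completion.denseRange_coe (α := PreExtrap A μ)).comp
    (toPre A μ).surjective.denseRange (UniformSpace.Completion.continuous_coe _)

theorem incl_injective {A : X →ₗ.[𝕜] X} {μ : 𝕜} (hμ : μ ∈ resolventSet A) :
    Function.Injective (incl A μ) := by
  refine (injective_iff_map_eq_zero _).2 fun x hx => ?_
  have h : ‖resolvent A μ x‖ = 0 := by rw [← norm_incl, hx, norm_zero]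
  exact resolvent_injective hμ (by rw [norm_eq_zero.1 h, map_zero])

/-- The bounded extension `A₋₁ : X → X₋₁` of `A : D(A) ⊆ X → X ⊆ X₋₁`. -/
def extrapGen (A : X →ₗ.[𝕜] X) (μ : 𝕜) : X →L[𝕜] Extrap A μ :=
  ((incl A μ).toLinearMap ∘ₗ A.toFun).extendOfNorm A.domain.subtype

theorem extrapGen_apply {A : X →ₗ.[𝕜] X} {μ : 𝕜} (hμ : μ ∈ resolventSet A)
    (hA : Dense (A.domain : Set X)) (x : A.domain) :
    extrapGen A μ (x : X) = incl A μ (A x) := by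
  refine LinearMap.extendOfNorm_eq (f := (incl A μ).toLinearMap ∘ₗ A.toFun)
    (e := A.domain.subtype) (by simpa [DenseRange] using hA)
    ⟨‖resolvent A μ‖ * ‖μ‖ + 1, fun z => ?_⟩ x
  change ‖incl A μ (A z)‖ ≤ _ * ‖(z : X)‖
  rw [norm_incl]
  have h1 := (isResolventAt_resolvent hμ).1 z
  have h2 : resolvent A μ (A z) = resolvent A μ (μ • (z : X)) - z := by
    rw [map_sub] at h1
    exact eq_sub_of_add_eq (by rw [add_comm]; exact (sub_eq_iff_eq_add.1 h1).symm)
  rw [h2]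
  calc ‖resolvent A μ (μ • (z : X)) - z‖ ≤ ‖resolvent A μ (μ • (z : X))‖ + ‖(z : X)‖ :=
        norm_sub_le _ _
    _ ≤ ‖resolvent A μ‖ * ‖μ • (z : X)‖ + ‖(z : X)‖ := by
        gcongr; exact (resolvent A μ).le_opNorm _
    _ = _ := by rw [norm_smul]; ring

/-- The bounded extension to `X₋₁` of a bounded operator of `X`. -/
def extrapExt (A : X →ₗ.[𝕜] X) (μ : 𝕜) (C : X →L[𝕜] X) : Extrap A μ →L[𝕜] Extrap A μ :=
  ((incl A μ).toLinearMap ∘ₗ C.toLinearMap).extendOfNorm (incl A μ).toLinearMap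

/-- The extrapolated semigroup `S₋₁`: `S₋₁(t)` is the bounded extension of `S(t)` to `X₋₁`. -/
def extrapSemigroup (S : C0Semigroup 𝕜 X) (A : X →ₗ.[𝕜] X) (μ : 𝕜) (t : ℝ) :
    Extrap A μ →L[𝕜] Extrap A μ :=
  extrapExt A μ (S.op t)

theorem resolvent_op_comm {S : C0Semigroup 𝕜 X} {A : X →ₗ.[𝕜] X} (hS : S.IsGeneratedBy A)
    {μ : 𝕜} (hμ : μ ∈ resolventSet A) {t : ℝ} (ht : 0 ≤ t) (x : X) :
    resolvent A μ (S.op t x) = S.op t (resolvent A μ x) := by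
  obtain ⟨hz, hx⟩ := (isResolventAt_resolvent hμ).2 x
  set z : X := resolvent A μ x with hzdef
  have hg : (z, A ⟨z, hz⟩) ∈ A.graph := A.mem_graph ⟨z, hz⟩
  have h1 := (hS _ _).1 hg
  have h2 : (S.op t z, S.op t (A ⟨z, hz⟩)) ∈ A.graph := by
    rw [hS]
    refine (((S.op t).continuous.tendsto _).comp h1).congr' ?_
    filter_upwards [self_mem_nhdsWithin] with h hh
    have h3 : S.op t (S.op h z) = S.op h (S.op t z) := by
      have h5 := S.op_add t h ht (le_of_lt hh)
      rw [add_comm, S.op_add h t (le_of_lt hh) ht] at h5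
      exact (DFunLike.congr_fun h5 z).symm
    simp [h3]
  obtain ⟨y, hy1, hy2⟩ := (LinearPMap.mem_graph_iff A).1 h2
  have h4 := (isResolventAt_resolvent hμ).1 y
  simp only at hy1 hy2
  rw [hy1, hy2, ← map_smul, ← map_sub, hx] at h4
  exact h4

theorem extrapSemigroup_incl {S : C0Semigroup 𝕜 X} {A : X →ₗ.[𝕜] X} (hS : S.IsGeneratedBy A)
    {μ : 𝕜} (hμ : μ ∈ resolventSet A) {t : ℝ} (ht : 0 ≤ t) (x : X) :
    extrapSemigroup S A μ t (incl A μ x) = incl A μ (S.op t x) := by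
  refine LinearMap.extendOfNorm_eq (f := (incl A μ).toLinearMap ∘ₗ (S.op t).toLinearMap)
    (e := (incl A μ).toLinearMap) (denseRange_incl A μ) ⟨‖S.op t‖, fun z => ?_⟩ x
  change ‖incl A μ (S.op t z)‖ ≤ ‖S.op t‖ * ‖incl A μ z‖
  rw [norm_incl, norm_incl, resolvent_op_comm hS hμ ht]
  exact (S.op t).le_opNorm _

/-- The part `C|_X` in `X` of `C : X → X₋₁`: the operator with domain `{x | C x ∈ X}` given
by `x ↦ C x`. It is defined through its graph `{(x, y) | C x = i y}`. -/
def part (A : X →ₗ.[𝕜] X) (μ : 𝕜) (C : X →L[𝕜] Extrap A μ) : X →ₗ.[𝕜] X :=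
  Submodule.toLinearPMap
    (LinearMap.eqLocus (C.toLinearMap ∘ₗ LinearMap.fst 𝕜 X X)
      ((incl A μ).toLinearMap ∘ₗ LinearMap.snd 𝕜 X X))

theorem mem_graph_part {A : X →ₗ.[𝕜] X} {μ : 𝕜} (hμ : μ ∈ resolventSet A)
    (C : X →L[𝕜] Extrap A μ) (x y : X) :
    (x, y) ∈ (part A μ C).graph ↔ C x = incl A μ y := by
  rw [part, Submodule.toLinearPMap_graph_eq]
  · simp [LinearMap.mem_eqLocus]
  · rintro ⟨x, y⟩ hxy hx
    simp only [LinearMap.mem_eqLocus, LinearMap.comp_apply, LinearMap.fst_apply,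
      LinearMap.snd_apply, ContinuousLinearMap.coe_coe] at hxy hx ⊢
    rw [hx, map_zero] at hxy
    exact incl_injective hμ (by rw [← hxy, map_zero])

open Classical in
/-- The component in `X` of `z = i y + w`, `w ∈ W`, that is, the image of `z` under the projection
onto `X ≅ i(X)` along `W` (and `0` if `z ∉ i(X) + W`). -/
def projX (A : X →ₗ.[𝕜] X) (μ : 𝕜) (W : Submodule 𝕜 (Extrap A μ)) (z : Extrap A μ) : X :=
  if h : ∃ y : X, z - incl A μ y ∈ W then h.choose else 0

theorem projX_eq {A : X →ₗ.[𝕜] X} {μ : 𝕜} (hμ : μ ∈ resolventSet A)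
    {W : Submodule 𝕜 (Extrap A μ)} (hW : Disjoint (LinearMap.range (incl A μ).toLinearMap) W)
    (y : X) {w : Extrap A μ} (hw : w ∈ W) : projX A μ W (incl A μ y + w) = y := by
  have h : ∃ y' : X, incl A μ y + w - incl A μ y' ∈ W := ⟨y, by simpa using hw⟩
  rw [projX, dif_pos h]
  have h1 := W.sub_mem h.choose_spec hw
  have h2 : incl A μ (y - h.choose) ∈ W := by
    rw [map_sub]; convert h1 using 1; abel
  have h3 := Submodule.disjoint_def.1 hW _ ⟨y - h.choose, rfl⟩ h2
  have h4 : y - h.choose = 0 := incl_injective hμ (by simpa using h3)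
  exact (sub_eq_zero.1 h4).symm

/-- `B` is `p`-admissible: for some `T > 0`, the integral of `S₋₁(T - s) B u(s)` over `[0, T]`
lies in `X` for every `u ∈ L^p(0, T; X)`. -/
def IsPAdmissible (S : C0Semigroup 𝕜 X) (A : X →ₗ.[𝕜] X) (μ : 𝕜) (B : X →L[𝕜] Extrap A μ)
    (p : ℝ) : Prop :=
  ∃ T : ℝ, 0 < T ∧ ∀ u : ℝ → X, MemLp u (ENNReal.ofReal p) (volume.restrict (Set.Ioc 0 T)) →
    ∃ y : X, incl A μ y = ∫ s in (0 : ℝ)..T, extrapSemigroup S A μ (T - s) (B (u s))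

/-- `x` is a global mild solution of `x' = A x - ρ B x`, `x(0) = x₀`: an `X`-valued continuous
function on `[0, ∞)` that satisfies the variation of parameters formula in `X₋₁`. -/
def IsMildSolution (S : C0Semigroup 𝕜 X) (A : X →ₗ.[𝕜] X) (μ : 𝕜) (B : X →L[𝕜] Extrap A μ)
    (ρ : ℝ) (x₀ : X) (x : ℝ → X) : Prop :=
  ContinuousOn x (Set.Ici 0) ∧ ∀ t : ℝ, 0 ≤ t →
    incl A μ (x t) = incl A μ (S.op t x₀) -
      ρ • ∫ s in (0 : ℝ)..t, extrapSemigroup S A μ (t - s) (B (x s))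

end Extrapolation

section Hilbert

variable {𝕜 X : Type*} [RCLike 𝕜] [NormedAddCommGroup X] [InnerProductSpace 𝕜 X]

/-- The sum of `i(X)` and `W` in `X₋₁` is direct and is an admissible decomposition for the pair
`(K, L)`: the ranges of `K` and `L` lie in the sum, the `X`-component of `K` is dissipative on the
domain `{x | K x + L x ∈ X}` of the part of `K + L`, and the `X`-component of `L` is a bounded
operator of `X`. The subspace `W` need not be closed. -/
structure IsAdmissibleDecomposition (A : X →ₗ.[𝕜] X) (μ : 𝕜) (W : Submodule 𝕜 (Extrap A μ))
    (K L : X →L[𝕜] Extrap A μ) : Prop where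
  direct : Disjoint (LinearMap.range (incl A μ).toLinearMap) W
  range_left : ∀ x : X, K x ∈ LinearMap.range (incl A μ).toLinearMap ⊔ W
  range_right : ∀ x : X, L x ∈ LinearMap.range (incl A μ).toLinearMap ⊔ W
  dissipative : ∀ x : X, x ∈ (part A μ (K + L)).domain →
    RCLike.re (inner 𝕜 (projX A μ W (K x)) x) ≤ 0
  bounded : ∃ L' : X →L[𝕜] X, ∀ x : X, L' x = projX A μ W (L x)

end Hilbert

end RangeDecomposition

end

/-!
The stability of `x' = A x - ρ B x` for small `ρ > 0` comes from an energy estimate over one period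
`[0, T]`. Let `C` be the `X`-component of `B`, a bounded operator. On the domain of the generator of
the perturbed semigroup `U`, the component of `(A₋₁ - ρ B) x` in `W` vanishes, so that
`(A₋₁ - ρ B) x = a - ρ C x` with `a` the `X`-component of `A₋₁ x`, and the dissipativity of
`x ↦ a` gives
  `‖U(T) x‖² + 2 ρ ∫₀ᵀ Re ⟪C U(t) x, U(t) x⟫ dt ≤ ‖x‖²`
(`IsPerturbedSemigroup.norm_sq_add_le`). Since `‖U(t) x - S(t) x‖ = O(ρ) ‖x‖` on `[0, T]`, replacing
`U` by `S` under the integral costs `O(ρ²) ‖x‖²`, and the observability estimate yields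
  `(1 + ρ δ) ‖U(T) x‖² ≤ (1 + κ ρ²) ‖x‖²`
(`IsPerturbedSemigroup.norm_sq_op_le`). For small `ρ` the operator `U(T)` is a strict contraction,
and `U` decays exponentially.

The extrapolation space is eliminated: the resolvent `R = (μ I - A)⁻¹` extends to an isometry of
`X₋₁` into `X` that intertwines `S₋₁` with `S` (`extrapResolvent`). With `b` the image of `B` under
it, `i y = ∫ S₋₁(t - s) B u(s) ds` becomes `R y = ∫ S(t - s) b u(s) ds` (`duhamel`), and
`(A₋₁ - ρ B) x = i y` becomes `μ R x - x - ρ b x = R y`.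

The perturbed semigroup is constructed in these terms. By the closed graph theorem,
`p`-admissibility gives bounds for the displacement `R⁻¹ ∫₀ʰ S(h - s) b u(s) ds`, of order `h^{1/p}`
for short times (`exists_short_time_bound`) and uniform in the weighted norm `sup e^{-t} ‖u(t)‖`
for all times (`exists_global_bound`). Hence, for small `ρ`, the Volterra equation of the mild
solutions is uniquely solvable by a Neumann series. Its generator is identified through a cocycle
argument (`IsPerturbedSemigroup.op_eq_add_integral`).
-/

noncomputable section

namespace RangeDecomposition

/-! ### Orbits of contraction semigroups -/

section Orbits

variable {𝕜 X : Type*} [RCLike 𝕜] [NormedAddCommGroup X] [NormedSpace 𝕜 X]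

theorem C0Semigroup.op_add_apply (S : C0Semigroup 𝕜 X) {s t : ℝ} (hs : 0 ≤ s) (ht : 0 ≤ t) (x : X) :
    S.op (s + t) x = S.op s (S.op t x) := by
  rw [S.op_add s t hs ht]; rfl

theorem C0Semigroup.op_zero_apply (S : C0Semigroup 𝕜 X) (x : X) : S.op 0 x = x := by
  rw [S.op_zero]; rfl

theorem C0Semigroup.IsContractive.norm_op_le {S : C0Semigroup 𝕜 X} (hS : S.IsContractive) {t : ℝ}
    (ht : 0 ≤ t) (x : X) : ‖S.op t x‖ ≤ ‖x‖ := by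
  simpa using (S.op t).le_of_opNorm_le (hS t ht) x

theorem C0Semigroup.IsContractive.norm_op_sub_op_le {S : C0Semigroup 𝕜 X} (hS : S.IsContractive)
    {s t : ℝ} (hs : 0 ≤ s) (ht : 0 ≤ t) (x : X) :
    ‖S.op t x - S.op s x‖ ≤ ‖S.op |t - s| x - x‖ := by
  wlog hst : s ≤ t generalizing s t
  · rw [norm_sub_rev, abs_sub_comm]
    exact this ht hs (le_of_not_ge hst)
  · rw [abs_of_nonneg (sub_nonneg.2 hst)]
    have h : S.op t x = S.op s (S.op (t - s) x) := by
      rw [← S.op_add_apply hs (sub_nonneg.2 hst)]; congr 2; ring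
    rw [h, ← map_sub]
    exact hS.norm_op_le hs _

/-- A contraction semigroup is jointly strongly continuous in time and state. Negative times are
cut off, as the semigroup carries no information there. -/
theorem C0Semigroup.IsContractive.continuous_uncurry {S : C0Semigroup 𝕜 X}
    (hS : S.IsContractive) : Continuous fun z : ℝ × X => S.op (max z.1 0) z.2 := by
  rw [continuous_iff_continuousAt]
  rintro ⟨t, x⟩
  rw [ContinuousAt, tendsto_iff_norm_sub_tendsto_zero]
  have h0 : Tendsto (fun h : ℝ => ‖S.op h x - x‖) (𝓝[≥] 0) (𝓝 0) := by
    have h1 : ContinuousWithinAt (fun h : ℝ => S.op h x) (Set.Ioi 0) 0 := by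
      simpa [ContinuousWithinAt, S.op_zero_apply] using S.tendsto_zero x
    have h2 : ContinuousWithinAt (fun h : ℝ => S.op h x) (Set.Ici 0) 0 := by
      rw [← Set.Ioi_insert]
      exact h1.insert
    have h3 := (h2.sub_const x).norm
    simpa [ContinuousWithinAt, S.op_zero_apply] using h3
  have h4 : Tendsto (fun z : ℝ × X => |max z.1 0 - max t 0|) (𝓝 (t, x)) (𝓝[≥] 0) := by
    refine tendsto_nhdsWithin_iff.2 ⟨?_, Eventually.of_forall fun z => Set.mem_Ici.2 (abs_nonneg _)⟩
    have : Continuous fun z : ℝ × X => |max z.1 0 - max t 0| := by fun_prop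
    simpa using this.tendsto (t, x)
  have h5 : Tendsto (fun z : ℝ × X => ‖z.2 - x‖) (𝓝 (t, x)) (𝓝 0) := by
    have : Continuous fun z : ℝ × X => ‖z.2 - x‖ := by fun_prop
    simpa using this.tendsto (t, x)
  refine squeeze_zero (fun _ => norm_nonneg _) (fun z => ?_)
    (by simpa using h5.add (h0.comp h4))
  have h6 : S.op (max z.1 0) z.2 - S.op (max t 0) x =
      S.op (max z.1 0) (z.2 - x) + (S.op (max z.1 0) x - S.op (max t 0) x) := by
    rw [map_sub]; abel
  dsimp only [Function.comp_apply]
  rw [h6]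
  refine (norm_add_le _ _).trans (add_le_add (hS.norm_op_le (le_max_right _ _) _) ?_)
  exact hS.norm_op_sub_op_le (le_max_right _ _) (le_max_right _ _) x

theorem C0Semigroup.IsContractive.continuousOn_orbit {S : C0Semigroup 𝕜 X}
    (hS : S.IsContractive) (x : X) : ContinuousOn (fun t => S.op t x) (Set.Ici 0) := by
  have h : Continuous fun t : ℝ => S.op (max t 0) x :=
    hS.continuous_uncurry.comp (continuous_id.prodMk continuous_const)
  refine h.continuousOn.congr fun t ht => ?_
  simp only [max_eq_left (Set.mem_Ici.1 ht)]

end Orbits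

/-! ### Duhamel integrals -/

section Duhamel

variable {𝕜 X : Type*} [RCLike 𝕜] [NormedAddCommGroup X] [NormedSpace 𝕜 X]
  {S : C0Semigroup 𝕜 X} {b : X →L[𝕜] X}

theorem intervalIntegrable_duhamel (hS : S.IsContractive) {t : ℝ} (ht : 0 ≤ t) {u : ℝ → X}
    (hu : IntervalIntegrable u volume 0 t) :
    IntervalIntegrable (fun s => S.op (t - s) (b (u s))) volume 0 t := by
  rw [intervalIntegrable_iff_integrableOn_Ioc_of_le ht] at hu ⊢
  refine Integrable.mono' (hu.norm.const_mul ‖b‖) ?_ ?_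
  · have h1 : AEStronglyMeasurable (fun s => S.op (max (t - s) 0) (b (u s)))
        (volume.restrict (Set.Ioc 0 t)) := by
      have h2 : AEStronglyMeasurable (fun s => (t - s, b (u s)))
          (volume.restrict (Set.Ioc 0 t)) := by
        refine AEStronglyMeasurable.prodMk ?_ (b.continuous.comp_aestronglyMeasurable hu.1)
        exact (by fun_prop : Continuous fun s : ℝ => t - s).aestronglyMeasurable
      exact hS.continuous_uncurry.comp_aestronglyMeasurable h2
    refine h1.congr ?_
    filter_upwards [ae_restrict_mem measurableSet_Ioc] with s hs
    rw [max_eq_left (sub_nonneg.2 hs.2)]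
  · filter_upwards [ae_restrict_mem measurableSet_Ioc] with s hs
    exact (hS.norm_op_le (sub_nonneg.2 hs.2) _).trans (b.le_opNorm _)

variable [NormedSpace ℝ X]

/-- The Duhamel integral `∫₀ᵗ S(t - s) b u(s) ds` with a bounded input operator `b` of `X`. -/
def duhamel (S : C0Semigroup 𝕜 X) (b : X →L[𝕜] X) (t : ℝ) (u : ℝ → X) : X :=
  ∫ s in (0 : ℝ)..t, S.op (t - s) (b (u s))

theorem duhamel_zero (u : ℝ → X) : duhamel S b 0 u = 0 := by
  simp [duhamel]

theorem duhamel_congr {t : ℝ} (ht : 0 ≤ t) {u v : ℝ → X} (h : ∀ s ∈ Set.Icc 0 t, u s = v s) :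
    duhamel S b t u = duhamel S b t v := by
  refine intervalIntegral.integral_congr fun s hs => ?_
  rw [Set.uIcc_of_le ht] at hs
  simp only [h s hs]

theorem duhamel_congr_ae {t : ℝ} (ht : 0 ≤ t) {u v : ℝ → X}
    (h : u =ᵐ[volume.restrict (Set.Ioc 0 t)] v) :
    duhamel S b t u = duhamel S b t v := by
  rw [duhamel, duhamel, intervalIntegral.integral_of_le ht, intervalIntegral.integral_of_le ht]
  refine integral_congr_ae ?_
  filter_upwards [h] with s hs
  rw [hs]

theorem norm_duhamel_le (hS : S.IsContractive) {t : ℝ} (ht : 0 ≤ t) {u : ℝ → X}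
    (hu : IntervalIntegrable u volume 0 t) :
    ‖duhamel S b t u‖ ≤ ‖b‖ * ∫ s in (0 : ℝ)..t, ‖u s‖ := by
  rw [duhamel, ← intervalIntegral.integral_const_mul]
  refine (intervalIntegral.norm_integral_le_integral_norm ht).trans ?_
  refine intervalIntegral.integral_mono_on ht (intervalIntegrable_duhamel hS ht hu).norm
    (hu.norm.const_mul _) fun s hs => ?_
  exact (hS.norm_op_le (sub_nonneg.2 hs.2) _).trans (b.le_opNorm _)

theorem duhamel_fun_add (hS : S.IsContractive) {t : ℝ} (ht : 0 ≤ t) {u v : ℝ → X}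
    (hu : IntervalIntegrable u volume 0 t) (hv : IntervalIntegrable v volume 0 t) :
    duhamel S b t (fun s => u s + v s) = duhamel S b t u + duhamel S b t v := by
  simp only [duhamel, map_add]
  exact intervalIntegral.integral_add (intervalIntegrable_duhamel hS ht hu)
    (intervalIntegrable_duhamel hS ht hv)

theorem duhamel_fun_sub (hS : S.IsContractive) {t : ℝ} (ht : 0 ≤ t) {u v : ℝ → X}
    (hu : IntervalIntegrable u volume 0 t) (hv : IntervalIntegrable v volume 0 t) :
    duhamel S b t (fun s => u s - v s) = duhamel S b t u - duhamel S b t v := by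
  simp only [duhamel, map_sub]
  exact intervalIntegral.integral_sub (intervalIntegrable_duhamel hS ht hu)
    (intervalIntegrable_duhamel hS ht hv)

theorem duhamel_fun_smul [IsScalarTower ℝ 𝕜 X] (t : ℝ) (u : ℝ → X) (c : 𝕜) :
    duhamel S b t (fun s => c • u s) = c • duhamel S b t u := by
  simp only [duhamel, map_smul]
  exact intervalIntegral.integral_smul c _

/-- The cocycle property: the input over `[0, h]` is propagated by `S t`, the remaining input acts
over `[h, t + h]`. -/
theorem duhamel_add [CompleteSpace X] [IsScalarTower ℝ 𝕜 X] (hS : S.IsContractive) {t h : ℝ}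
    (ht : 0 ≤ t) (hh : 0 ≤ h) {u : ℝ → X} (hu : IntervalIntegrable u volume 0 (t + h)) :
    duhamel S b (t + h) u = S.op t (duhamel S b h u) + duhamel S b t (fun s => u (s + h)) := by
  have hint := intervalIntegrable_duhamel (b := b) hS (add_nonneg ht hh) hu
  have hsub : Set.uIcc 0 h ⊆ Set.uIcc 0 (t + h) := by
    rw [Set.uIcc_of_le hh, Set.uIcc_of_le (add_nonneg ht hh)]
    exact Set.Icc_subset_Icc_right (by linarith)
  have hsub' : Set.uIcc h (t + h) ⊆ Set.uIcc 0 (t + h) := by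
    rw [Set.uIcc_of_le (by linarith : h ≤ t + h), Set.uIcc_of_le (add_nonneg ht hh)]
    exact Set.Icc_subset_Icc_left hh
  have h1 := intervalIntegrable_duhamel (b := b) hS hh (hu.mono_set hsub)
  rw [duhamel, ← intervalIntegral.integral_add_adjacent_intervals
    (hint.mono_set hsub) (hint.mono_set hsub')]
  congr 1
  · rw [duhamel, ← ContinuousLinearMap.intervalIntegral_comp_comm _ h1]
    refine intervalIntegral.integral_congr fun s hs => ?_
    rw [Set.uIcc_of_le hh] at hs
    rw [← S.op_add_apply ht (sub_nonneg.2 hs.2)]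
    congr 2; ring
  · have h2 := intervalIntegral.integral_comp_add_right (a := 0) (b := t)
      (fun s => S.op (t + h - s) (b (u s))) h
    rw [zero_add] at h2
    rw [← h2, duhamel]
    refine intervalIntegral.integral_congr fun s _ => ?_
    congr 2; ring

end Duhamel

/-! ### Consequences of admissibility -/

section Admissibility

variable {𝕜 X : Type*} [RCLike 𝕜] [NormedAddCommGroup X]

theorem intervalIntegrable_of_memLp {p : ENNReal} (hp : 1 ≤ p) {T : ℝ} (hT : 0 ≤ T) {u : ℝ → X}
    (hu : MemLp u p (volume.restrict (Set.Ioc 0 T))) : IntervalIntegrable u volume 0 T := by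
  rw [intervalIntegrable_iff_integrableOn_Ioc_of_le hT]
  exact hu.integrable hp

variable [NormedSpace 𝕜 X] [NormedSpace ℝ X] {S : C0Semigroup 𝕜 X} {b R : X →L[𝕜] X}

/-- The Duhamel integral is bounded on `L^p`, as `L^p` embeds into `L^1` over a bounded interval. -/
theorem exists_norm_duhamel_le_eLpNorm (hS : S.IsContractive) {p : ENNReal} (hp : 1 ≤ p) {T : ℝ}
    (hT : 0 ≤ T) : ∃ C : ℝ, ∀ u : ℝ → X, MemLp u p (volume.restrict (Set.Ioc 0 T)) →
      ‖duhamel S b T u‖ ≤ C * (eLpNorm u p (volume.restrict (Set.Ioc 0 T))).toReal := by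
  set ν := (volume : Measure ℝ).restrict (Set.Ioc 0 T) with hν
  refine ⟨‖b‖ * (ν Set.univ ^ (1 / (1 : ENNReal).toReal - 1 / p.toReal)).toReal, fun u hu => ?_⟩
  have hi := intervalIntegrable_of_memLp hp hT hu
  refine (norm_duhamel_le hS hT hi).trans ?_
  rw [mul_assoc]
  refine mul_le_mul_of_nonneg_left ?_ (norm_nonneg _)
  have h1 : ∫ s in (0 : ℝ)..T, ‖u s‖ = (eLpNorm u 1 ν).toReal := by
    rw [intervalIntegral.integral_of_le hT, integral_norm_eq_lintegral_enorm hu.1,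
      eLpNorm_one_eq_lintegral_enorm]
  rw [h1, mul_comm, ← ENNReal.toReal_mul]
  refine ENNReal.toReal_mono (ENNReal.mul_ne_top hu.2.ne ?_)
    (eLpNorm_le_eLpNorm_mul_rpow_measure_univ hp hu.1)
  have h3 : 0 ≤ 1 / (1 : ENNReal).toReal - 1 / p.toReal := by
    rcases eq_or_ne p ⊤ with rfl | hpt
    · simp
    · have : 1 ≤ p.toReal := by
        simpa using ENNReal.toReal_mono hpt hp
      have := (div_le_one (by linarith)).2 this
      simpa using this
  exact ENNReal.rpow_ne_top_of_nonneg h3 (by simp [hν])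

variable [CompleteSpace X] [IsScalarTower ℝ 𝕜 X]

/-- If the Duhamel integrals over `[0, T]` of all `L^p` inputs lie in the range of the injective
operator `R`, then their preimages depend boundedly on the input: the preimage map has a closed
graph. -/
theorem exists_bound_of_forall_memLp (hS : S.IsContractive) (hR : Function.Injective R)
    {p : ENNReal} (hp : 1 ≤ p) {T : ℝ} (hT : 0 ≤ T)
    (hadm : ∀ u : ℝ → X, MemLp u p (volume.restrict (Set.Ioc 0 T)) →
      ∃ y, R y = duhamel S b T u) :
    ∃ c : ℝ, 0 ≤ c ∧ ∀ u : ℝ → X, MemLp u p (volume.restrict (Set.Ioc 0 T)) →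
      ∃ y, R y = duhamel S b T u ∧
        ‖y‖ ≤ c * (eLpNorm u p (volume.restrict (Set.Ioc 0 T))).toReal := by
  set ν := (volume : Measure ℝ).restrict (Set.Ioc 0 T) with hν
  have : Fact (1 ≤ p) := ⟨hp⟩
  have hmem : ∀ f : Lp X p ν, MemLp f p ν := Lp.memLp
  choose g hg using fun f : Lp X p ν => hadm f (hmem f)
  have hii : ∀ f : Lp X p ν, IntervalIntegrable f volume 0 T := fun f =>
    intervalIntegrable_of_memLp hp hT (hmem f)
  let L : Lp X p ν →ₗ[𝕜] X :=
    { toFun := g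
      map_add' := fun f₁ f₂ => hR <| by
        rw [map_add, hg, hg, hg, ← duhamel_fun_add hS hT (hii f₁) (hii f₂)]
        exact duhamel_congr_ae hT (Lp.coeFn_add f₁ f₂)
      map_smul' := fun c f => hR <| by
        rw [RingHom.id_apply, map_smul, hg, hg, ← duhamel_fun_smul]
        exact duhamel_congr_ae hT (Lp.coeFn_smul c f) }
  obtain ⟨C, hC⟩ := exists_norm_duhamel_le_eLpNorm (b := b) hS hp hT
  have hcont : Continuous L := by
    refine LinearMap.continuous_of_seq_closed_graph (g := L) fun f f₀ y hf hy => hR ?_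
    have h1 : Tendsto (fun n => duhamel S b T (f n)) atTop (𝓝 (R y)) := by
      refine ((R.continuous.tendsto y).comp hy).congr fun n => ?_
      exact hg (f n)
    refine tendsto_nhds_unique h1 ?_
    have h2 : R (L f₀) = duhamel S b T f₀ := hg f₀
    rw [h2, tendsto_iff_norm_sub_tendsto_zero]
    have h3 : Tendsto (fun n => C * ‖f n - f₀‖) atTop (𝓝 0) := by
      simpa using (tendsto_iff_norm_sub_tendsto_zero.1 hf).const_mul C
    refine squeeze_zero (fun _ => norm_nonneg _) (fun n => ?_) h3
    have h4 : duhamel S b T (f n - f₀ : Lp X p ν) = duhamel S b T (f n) - duhamel S b T f₀ := by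
      rw [← duhamel_fun_sub hS hT (hii _) (hii _)]
      exact duhamel_congr_ae hT (Lp.coeFn_sub (f n) f₀)
    rw [← h4]
    exact hC _ (hmem _)
  let L' : Lp X p ν →L[𝕜] X := ⟨L, hcont⟩
  refine ⟨‖L'‖, norm_nonneg _, fun u hu => ⟨L' (hu.toLp u), ?_, ?_⟩⟩
  · exact (hg _).trans (duhamel_congr_ae hT hu.coeFn_toLp)
  · have := L'.le_opNorm (hu.toLp u)
    rwa [Lp.norm_toLp] at this

/-- Bounds for short times: an input of size `m` on `[0, h]` moves the state by `O(h^{1/p} m)`. It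
is prolonged by zero to the past, so that it acts at the end of the interval `[0, T]`. -/
theorem exists_short_time_bound (hS : S.IsContractive) (hR : Function.Injective R)
    {p : ℝ} (hp : 1 < p) {T : ℝ} (hT : 0 ≤ T)
    (hadm : ∀ u : ℝ → X, MemLp u (ENNReal.ofReal p) (volume.restrict (Set.Ioc 0 T)) →
      ∃ y, R y = duhamel S b T u) :
    ∃ c : ℝ, 0 ≤ c ∧ ∀ h : ℝ, 0 ≤ h → h ≤ T → ∀ (u : ℝ → X) (m : ℝ), Continuous u →
      (∀ s ∈ Set.Icc 0 h, ‖u s‖ ≤ m) →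
      ∃ y, R y = duhamel S b h u ∧ ‖y‖ ≤ c * h ^ (1 / p) * m := by
  have hp1 : 1 ≤ ENNReal.ofReal p := by
    simpa using ENNReal.ofReal_le_ofReal hp.le
  obtain ⟨c, hc, hbound⟩ := exists_bound_of_forall_memLp hS hR hp1 hT hadm
  refine ⟨c, hc, fun h hh hhT u m hu hm => ?_⟩
  have hm0 : 0 ≤ m := (norm_nonneg _).trans (hm 0 ⟨le_rfl, hh⟩)
  set d := T - h with hd
  have hd0 : 0 ≤ d := sub_nonneg.2 hhT
  set v : ℝ → X := (Set.Ioc d T).indicator fun s => u (s - d) with hv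
  have hvle : ∀ s, ‖v s‖ ≤ ‖(Set.Ioc d T).indicator (fun _ => m) s‖ := fun s => by
    by_cases hs : s ∈ Set.Ioc d T
    · simp only [hv, Set.indicator_of_mem hs]
      refine (hm _ ⟨by linarith [hs.1], by linarith [hs.2]⟩).trans (le_abs_self m)
    · simp [hv, Set.indicator_of_notMem hs]
  have hvmeas : StronglyMeasurable v :=
    ((hu.comp (continuous_sub_right d)).stronglyMeasurable).indicator measurableSet_Ioc
  have hind : eLpNorm ((Set.Ioc d T).indicator fun _ => m) (ENNReal.ofReal p)
      (volume.restrict (Set.Ioc 0 T)) ≤ ENNReal.ofReal (h ^ (1 / p) * m) := by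
    refine (eLpNorm_indicator_const_le m _).trans ?_
    rw [ENNReal.toReal_ofReal (by linarith), mul_comm, ENNReal.ofReal_mul (by positivity),
      Real.enorm_eq_ofReal hm0, ← ENNReal.ofReal_rpow_of_nonneg hh (by positivity)]
    gcongr
    refine (Measure.restrict_apply_le _ _).trans ?_
    rw [Real.volume_Ioc]
    simp [hd]
  have hvnorm : eLpNorm v (ENNReal.ofReal p) (volume.restrict (Set.Ioc 0 T)) ≤
      ENNReal.ofReal (h ^ (1 / p) * m) :=
    (eLpNorm_mono hvle).trans hind
  have hvLp : MemLp v (ENNReal.ofReal p) (volume.restrict (Set.Ioc 0 T)) :=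
    ⟨hvmeas.aestronglyMeasurable, hvnorm.trans_lt ENNReal.ofReal_lt_top⟩
  obtain ⟨y, hy, hyle⟩ := hbound v hvLp
  refine ⟨y, ?_, ?_⟩
  · have hTd : T = h + d := by rw [hd]; ring
    rw [hy, hTd, duhamel_add hS hh hd0
      (by rw [← hTd]; exact intervalIntegrable_of_memLp hp1 hT hvLp)]
    have h0 : duhamel S b d v = 0 := by
      rw [duhamel_congr (v := fun _ => 0) hd0 fun s hs => ?_]
      · simp [duhamel]
      · exact Set.indicator_of_notMem (fun h' => absurd h'.1 (not_lt.2 hs.2)) _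
    rw [h0, map_zero, zero_add]
    refine duhamel_congr_ae hh ?_
    filter_upwards [ae_restrict_mem measurableSet_Ioc] with s hs
    have hsd : s + d ∈ Set.Ioc d T := ⟨by linarith [hs.1], by linarith [hs.2]⟩
    rw [hv, Set.indicator_of_mem hsd]
    simp
  · rw [mul_assoc]
    refine hyle.trans (mul_le_mul_of_nonneg_left ?_ hc)
    exact ENNReal.toReal_le_of_le_ofReal (by positivity) hvnorm

/-- Bounds for all times, in the norm weighted by `e^{-t}`: the effects of the inputs over the
successive intervals of length `T` sum up to a geometric series. -/
theorem exists_global_bound (hS : S.IsContractive)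
    (hcomm : ∀ t : ℝ, 0 ≤ t → ∀ x, R (S.op t x) = S.op t (R x))
    {T : ℝ} (hT : 0 < T) {c : ℝ} (hc : 0 ≤ c)
    (hshort : ∀ h : ℝ, 0 ≤ h → h ≤ T → ∀ (u : ℝ → X) (m : ℝ), Continuous u →
      (∀ s ∈ Set.Icc 0 h, ‖u s‖ ≤ m) → ∃ y, R y = duhamel S b h u ∧ ‖y‖ ≤ c * m) :
    ∃ N : ℝ, 0 ≤ N ∧ ∀ t : ℝ, 0 ≤ t → ∀ (u : ℝ → X) (m : ℝ), Continuous u →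
      (∀ s ∈ Set.Icc 0 t, ‖u s‖ ≤ m * Real.exp s) →
      ∃ y, R y = duhamel S b t u ∧ ‖y‖ ≤ N * (m * Real.exp t) := by
  have hq : Real.exp (-T) < 1 := by simpa using hT
  have hq0 := Real.exp_pos (-T)
  set q := Real.exp (-T)
  have hN : c ≤ c / (1 - q) := le_div_self hc (by linarith) (by linarith)
  have hN0 : 0 ≤ c / (1 - q) := hc.trans hN
  have hNq : c / (1 - q) * q + c = c / (1 - q) := by
    have : 1 - q ≠ 0 := by linarith
    field_simp; ring
  -- The displacement over `[0, t]` is that over `[0, t - T]`, propagated over a time `T`, plus that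
  -- over the last interval of length `T`. The constant `N = c / (1 - q)` solves `N q + c = N`.
  refine ⟨c / (1 - q), hN0, fun t ht u m hu hm => ?_⟩
  set N := c / (1 - q)
  have hbase : ∀ (h : ℝ), 0 ≤ h → h ≤ T → ∀ (u : ℝ → X) (m : ℝ), Continuous u →
      (∀ s ∈ Set.Icc 0 h, ‖u s‖ ≤ m * Real.exp s) →
      ∃ y, R y = duhamel S b h u ∧ ‖y‖ ≤ c * (m * Real.exp h) := by
    intro h hh hhT u m hu hm
    have hm0 : 0 ≤ m := (norm_nonneg _).trans (by simpa using hm 0 ⟨le_rfl, hh⟩)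
    refine hshort h hh hhT u _ hu fun s hs => (hm s hs).trans ?_
    gcongr
    exact hs.2
  have key : ∀ n : ℕ, ∀ t : ℝ, 0 ≤ t → t ≤ n * T → ∀ (u : ℝ → X) (m : ℝ), Continuous u →
      (∀ s ∈ Set.Icc 0 t, ‖u s‖ ≤ m * Real.exp s) →
      ∃ y, R y = duhamel S b t u ∧ ‖y‖ ≤ N * (m * Real.exp t) := by
    intro n
    induction n with
    | zero =>
      intro t ht htn u m hu hm
      have h0 : t = 0 := le_antisymm (by simpa using htn) ht
      subst h0
      have hm0 : 0 ≤ m := (norm_nonneg _).trans (by simpa using hm 0 ⟨le_rfl, le_rfl⟩)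
      exact ⟨0, by simp [duhamel_zero], by simpa using mul_nonneg hN0 hm0⟩
    | succ n ih =>
      intro t ht htn u m hu hm
      have hm0 : 0 ≤ m := (norm_nonneg _).trans (by simpa using hm 0 ⟨le_rfl, ht⟩)
      by_cases htT : t ≤ T
      · obtain ⟨y, hy, hle⟩ := hbase t ht htT u m hu hm
        refine ⟨y, hy, hle.trans ?_⟩
        gcongr
      · have ht' : 0 ≤ t - T := by linarith
        obtain ⟨y₁, hy₁, hle₁⟩ := ih (t - T) ht' (by push_cast at htn; linarith) u m hu
          fun s hs => hm s ⟨hs.1, by linarith [hs.2]⟩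
        obtain ⟨y₂, hy₂, hle₂⟩ := hbase T hT.le le_rfl (fun s => u (s + (t - T)))
          (m * Real.exp (t - T)) (by fun_prop) fun s hs => by
            refine (hm (s + (t - T)) ⟨by linarith [hs.1], by linarith [hs.2]⟩).trans_eq ?_
            rw [Real.exp_add]; ring
        refine ⟨S.op T y₁ + y₂, ?_, ?_⟩
        · rw [map_add, hcomm T hT.le, hy₁, hy₂, ← duhamel_add hS hT.le ht'
            (hu.intervalIntegrable _ _)]
          congr 1; ring
        · have he : Real.exp (t - T) = q * Real.exp t := by
            rw [← Real.exp_add]; congr 1; ring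
          have he' : Real.exp (t - T) * Real.exp T = Real.exp t := by
            rw [← Real.exp_add]; congr 1; ring
          rw [he] at hle₁
          rw [mul_assoc, he'] at hle₂
          calc ‖S.op T y₁ + y₂‖ ≤ ‖y₁‖ + ‖y₂‖ :=
                (norm_add_le _ _).trans (add_le_add_left (hS.norm_op_le hT.le _) _)
            _ ≤ N * (m * (q * Real.exp t)) + c * (m * Real.exp t) := add_le_add hle₁ hle₂
            _ = (N * q + c) * (m * Real.exp t) := by ring
            _ = N * (m * Real.exp t) := by rw [hNq]
  obtain ⟨n, hn⟩ := exists_nat_ge (t / T)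
  exact key n t ht ((div_le_iff₀ hT).1 hn) u m hu hm

end Admissibility

/-! ### The perturbed semigroup -/

section Perturbation

variable {𝕜 X : Type*} [RCLike 𝕜] [NormedAddCommGroup X] [NormedSpace 𝕜 X] [NormedSpace ℝ X]

/-- The control `b` is admissible for the contraction semigroup `S`, expressed inside `X`: the
injective operator `R`, which commutes with `S`, represents the embedding of the state space into
the extrapolation space, and an input `u` moves the state by the `y` with `R y = duhamel S b t u`.
The displacement is bounded with constant `N` in the norms weighted by `e^{-t}`, and tends to `0`
with the length of the time interval. -/
structure IsBoundedControl (S : C0Semigroup 𝕜 X) (R b : X →L[𝕜] X) (N : ℝ) : Prop where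
  contractive : S.IsContractive
  injective : Function.Injective R
  comm : ∀ t : ℝ, 0 ≤ t → ∀ x, R (S.op t x) = S.op t (R x)
  nonneg : 0 ≤ N
  bound : ∀ t : ℝ, 0 ≤ t → ∀ (u : ℝ → X) (m : ℝ), Continuous u →
    (∀ s ∈ Set.Icc 0 t, ‖u s‖ ≤ m * Real.exp s) →
    ∃ y, R y = duhamel S b t u ∧ ‖y‖ ≤ N * (m * Real.exp t)
  short : ∃ T : ℝ, 0 < T ∧ ∃ c : ℝ, 0 ≤ c ∧ ∃ α : ℝ, 0 < α ∧ ∀ h : ℝ, 0 ≤ h → h ≤ T →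
    ∀ (u : ℝ → X) (m : ℝ), Continuous u → (∀ s ∈ Set.Icc 0 h, ‖u s‖ ≤ m) →
      ∃ y, R y = duhamel S b h u ∧ ‖y‖ ≤ c * h ^ α * m

/-- The displacement of the state at time `t` under the input `u`: the preimage under `R` of the
Duhamel integral, which exists for continuous inputs if `b` is a bounded control. -/
def displacement (S : C0Semigroup 𝕜 X) (R b : X →L[𝕜] X) (t : ℝ) (u : ℝ → X) : X :=
  Function.invFun R (duhamel S b t u)

variable {S : C0Semigroup 𝕜 X} {R b : X →L[𝕜] X} {N : ℝ}

namespace IsBoundedControl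

theorem displacement_eq (H : IsBoundedControl S R b N) {t : ℝ} {u : ℝ → X} {y : X}
    (hy : R y = duhamel S b t u) : displacement S R b t u = y := by
  rw [displacement, ← hy]
  exact Function.leftInverse_invFun H.injective y

theorem map_displacement (H : IsBoundedControl S R b N) {t : ℝ} (ht : 0 ≤ t) {u : ℝ → X}
    (hu : Continuous u) : R (displacement S R b t u) = duhamel S b t u := by
  obtain ⟨m, hm⟩ := (isCompact_Icc (a := (0 : ℝ)) (b := t)).exists_bound_of_continuousOn
    hu.continuousOn
  have hm0 : 0 ≤ m := (norm_nonneg _).trans (hm 0 ⟨le_rfl, ht⟩)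
  obtain ⟨y, hy, -⟩ := H.bound t ht u m hu fun s hs =>
    (hm s hs).trans (le_mul_of_one_le_right hm0 (Real.one_le_exp hs.1))
  rw [H.displacement_eq hy, hy]

theorem norm_displacement_le (H : IsBoundedControl S R b N) {t : ℝ} (ht : 0 ≤ t) {u : ℝ → X}
    {m : ℝ} (hu : Continuous u) (hm : ∀ s ∈ Set.Icc 0 t, ‖u s‖ ≤ m * Real.exp s) :
    ‖displacement S R b t u‖ ≤ N * (m * Real.exp t) := by
  obtain ⟨y, hy, hle⟩ := H.bound t ht u m hu hm
  rwa [H.displacement_eq hy]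

theorem norm_exp_smul_displacement_le (H : IsBoundedControl S R b N)
    (v : BoundedContinuousFunction ℝ X) (t : ℝ) :
    ‖Real.exp (-max t 0) • displacement S R b (max t 0) (fun s => Real.exp s • v s)‖ ≤
      N * ‖v‖ := by
  rw [norm_smul, Real.norm_eq_abs, Real.abs_exp, Real.exp_neg]
  have h := H.norm_displacement_le (le_max_right t 0)
    (by fun_prop : Continuous fun s => Real.exp s • v s) (m := ‖v‖) fun s _ => by
      rw [norm_smul, Real.norm_eq_abs, Real.abs_exp, mul_comm]
      gcongr
      exact v.norm_coe_le_norm s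
  rw [inv_mul_le_iff₀ (Real.exp_pos _)]
  exact h.trans_eq (by ring)

theorem norm_exp_smul_op_le (H : IsBoundedControl S R b N) (x : X) (t : ℝ) :
    ‖Real.exp (-max t 0) • S.op (max t 0) x‖ ≤ ‖x‖ := by
  rw [norm_smul, Real.norm_eq_abs, Real.abs_exp]
  have h1 : Real.exp (-max t 0) ≤ 1 := Real.exp_le_one_iff.2 (by simp)
  calc _ ≤ 1 * ‖x‖ := mul_le_mul h1 (H.contractive.norm_op_le (le_max_right _ _) x)
          (norm_nonneg _) zero_le_one
    _ = ‖x‖ := one_mul _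

/-- The unperturbed orbits `t ↦ e^{-t} S(t) x`, as bounded continuous functions. -/
def weightedOrbit [IsScalarTower ℝ 𝕜 X] (H : IsBoundedControl S R b N) :
    X →L[𝕜] BoundedContinuousFunction ℝ X :=
  LinearMap.mkContinuous
    { toFun := fun x => BoundedContinuousFunction.ofNormedAddCommGroup
        (fun t => Real.exp (-max t 0) • S.op (max t 0) x)
        ((by fun_prop : Continuous fun t : ℝ => Real.exp (-max t 0)).smul
          (H.contractive.continuous_uncurry.comp (continuous_id.prodMk continuous_const)))
        ‖x‖ (H.norm_exp_smul_op_le x)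
      map_add' := fun x y => by ext t; simp
      map_smul' := fun c x => by ext t; simp [smul_comm c] }
    1 fun x => by
      rw [one_mul]
      exact BoundedContinuousFunction.norm_ofNormedAddCommGroup_le _ (norm_nonneg x)
        (H.norm_exp_smul_op_le x)

theorem weightedOrbit_apply [IsScalarTower ℝ 𝕜 X] (H : IsBoundedControl S R b N) (x : X) {t : ℝ}
    (ht : 0 ≤ t) : H.weightedOrbit x t = Real.exp (-t) • S.op t x := by
  change Real.exp (-max t 0) • S.op (max t 0) _ = _
  rw [max_eq_left ht]

theorem norm_weightedOrbit_le [IsScalarTower ℝ 𝕜 X] (H : IsBoundedControl S R b N) (x : X) :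
    ‖H.weightedOrbit x‖ ≤ ‖x‖ :=
  BoundedContinuousFunction.norm_ofNormedAddCommGroup_le _ (norm_nonneg x)
    (H.norm_exp_smul_op_le x)

/-- Uniqueness for the perturbed Volterra equation, for inputs that are small with respect to the
bound of the control. -/
theorem eq_of_volterra_eq [IsScalarTower ℝ 𝕜 X] (H : IsBoundedControl S R b N) {ρ : ℝ}
    (hρ : 0 ≤ ρ) (hρN : ρ * N ≤ 1 / 2) {x y f : ℝ → X} (hx : Continuous x) (hy : Continuous y)
    (hxe : ∀ t, 0 ≤ t → R (x t) = f t - ρ • duhamel S b t x)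
    (hye : ∀ t, 0 ≤ t → R (y t) = f t - ρ • duhamel S b t y) {t : ℝ} (ht : 0 ≤ t) :
    x t = y t := by
  set d : ℝ → X := fun s => x s - y s with hd
  have hdc : Continuous d := hx.sub hy
  have hde : ∀ t, 0 ≤ t → d t = -(ρ • displacement S R b t d) := by
    intro t ht
    apply H.injective
    rw [map_neg, R.map_smul_of_tower, H.map_displacement ht hdc, hd,
      duhamel_fun_sub H.contractive ht (hx.intervalIntegrable _ _) (hy.intervalIntegrable _ _),
      map_sub, hxe t ht, hye t ht, smul_sub]
    abel
  -- Where the weighted norm of the difference `d` is largest, it is at most half of itself.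
  obtain ⟨s₀, hs₀, hmax⟩ := (isCompact_Icc (a := (0 : ℝ)) (b := t)).exists_isMaxOn
    ⟨0, le_rfl, ht⟩
    (by fun_prop : Continuous fun s => Real.exp (-s) * ‖d s‖).continuousOn
  have h1 : ∀ s ∈ Set.Icc 0 t, ‖d s‖ ≤ Real.exp (-s₀) * ‖d s₀‖ * Real.exp s := by
    intro s hs
    have h2 : Real.exp (-s) * ‖d s‖ ≤ Real.exp (-s₀) * ‖d s₀‖ := hmax hs
    rw [Real.exp_neg, inv_mul_le_iff₀ (Real.exp_pos s)] at h2
    linarith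
  have h3 := H.norm_displacement_le hs₀.1 hdc fun s hs => h1 s ⟨hs.1, hs.2.trans hs₀.2⟩
  have h4 : Real.exp (-s₀) * ‖d s₀‖ * Real.exp s₀ = ‖d s₀‖ := by
    rw [mul_right_comm, ← Real.exp_add]; simp
  rw [h4] at h3
  have h5 : ‖d s₀‖ ≤ 1 / 2 * ‖d s₀‖ := by
    conv_lhs => rw [hde s₀ hs₀.1, norm_neg, norm_smul, Real.norm_eq_abs, abs_of_nonneg hρ]
    calc ρ * _ ≤ ρ * (N * ‖d s₀‖) := by gcongr
      _ = ρ * N * ‖d s₀‖ := by ring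
      _ ≤ _ := by gcongr
  have h6 : ‖d s₀‖ = 0 := le_antisymm (by linarith) (norm_nonneg _)
  have h7 := h1 t ⟨ht, le_rfl⟩
  rw [h6] at h7
  have h8 : d t = 0 := by simpa using h7
  exact sub_eq_zero.1 h8

variable [CompleteSpace X] [IsScalarTower ℝ 𝕜 X]

theorem displacement_add_sub (H : IsBoundedControl S R b N) {t h : ℝ} (ht : 0 ≤ t) (hh : 0 ≤ h)
    {u : ℝ → X} (hu : Continuous u) :
    displacement S R b (t + h) u - displacement S R b t u =
      S.op t (displacement S R b h u) + displacement S R b t (fun s => u (s + h) - u s) := by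
  apply H.injective
  have hu' : Continuous fun s => u (s + h) := by fun_prop
  rw [map_sub, map_add, H.comm t ht, H.map_displacement (add_nonneg ht hh) hu,
    H.map_displacement ht hu, H.map_displacement hh hu,
    H.map_displacement (u := fun s => u (s + h) - u s) ht (hu'.sub hu),
    duhamel_add H.contractive ht hh (hu.intervalIntegrable _ _),
    duhamel_fun_sub H.contractive ht (hu'.intervalIntegrable _ _) (hu.intervalIntegrable _ _)]
  abel

/-- The displacement is uniformly continuous in time on bounded intervals: the input over `[0, h]`
has an effect of order `h^α`, and the rest is compared with the shifted input. -/
theorem exists_norm_displacement_sub_lt (H : IsBoundedControl S R b N) {u : ℝ → X}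
    (hu : Continuous u) (T₁ : ℝ) {ε : ℝ} (hε : 0 < ε) :
    ∃ η > 0, ∀ t h : ℝ, 0 ≤ t → t ≤ T₁ → 0 ≤ h → h < η →
      ‖displacement S R b (t + h) u - displacement S R b t u‖ < ε := by
  obtain ⟨T, hT, c, hc, α, hα, hshort⟩ := H.short
  obtain ⟨m, hm⟩ := (isCompact_Icc (a := (0 : ℝ)) (b := T)).exists_bound_of_continuousOn
    hu.continuousOn
  have hN := H.nonneg
  have huc := (isCompact_Icc (a := (0 : ℝ)) (b := T₁ + 1)).uniformContinuousOn_of_continuous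
    hu.continuousOn
  set C := N * Real.exp T₁ + 1 with hC
  have hC0 : 0 < C := by positivity
  obtain ⟨η₁, hη₁, huc⟩ := Metric.uniformContinuousOn_iff.1 huc (ε / (2 * C)) (by positivity)
  have hlim : Tendsto (fun h : ℝ => c * h ^ α * m) (𝓝 0) (𝓝 0) := by
    have h1 := (Real.continuousAt_rpow_const 0 α (Or.inr hα.le)).tendsto
    rw [Real.zero_rpow hα.ne'] at h1
    simpa using (h1.const_mul c).mul_const m
  obtain ⟨η₂, hη₂, hlim⟩ := Metric.eventually_nhds_iff.1
    (hlim.eventually (gt_mem_nhds (half_pos hε)))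
  refine ⟨min (min η₁ η₂) (min T 1), by positivity, fun t h ht htT hh hhη => ?_⟩
  simp only [lt_min_iff] at hhη
  obtain ⟨⟨hh₁, hh₂⟩, hhT, hh1⟩ := hhη
  rw [H.displacement_add_sub ht hh hu]
  obtain ⟨y, hy, hyle⟩ := hshort h hh hhT.le u m hu fun s hs => hm s ⟨hs.1, hs.2.trans hhT.le⟩
  have h1 : ‖S.op t (displacement S R b h u)‖ < ε / 2 := by
    rw [H.displacement_eq hy]
    refine (H.contractive.norm_op_le ht _).trans_lt (hyle.trans_lt (hlim ?_))
    rwa [Real.dist_eq, sub_zero, abs_of_nonneg hh]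
  have h2 : ‖displacement S R b t (fun s => u (s + h) - u s)‖ ≤
      N * (ε / (2 * C) * Real.exp t) := by
    refine H.norm_displacement_le ht (by fun_prop) fun s hs => ?_
    have h3 := huc (s + h) ⟨by linarith [hs.1], by linarith [hs.2]⟩ s
      ⟨hs.1, by linarith [hs.2]⟩ (by simpa [Real.dist_eq, abs_of_nonneg hh] using hh₁)
    rw [dist_eq_norm] at h3
    exact h3.le.trans (le_mul_of_one_le_right (by positivity) (Real.one_le_exp hs.1))
  have h4 : N * (ε / (2 * C) * Real.exp t) ≤ ε / 2 := by
    calc N * (ε / (2 * C) * Real.exp t) ≤ N * (ε / (2 * C) * Real.exp T₁) := by gcongr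
      _ = ε / 2 * ((N * Real.exp T₁) / C) := by field_simp
      _ ≤ ε / 2 * 1 := by
        gcongr
        exact (div_le_one hC0).2 (by linarith)
      _ = ε / 2 := mul_one _
  calc _ ≤ _ := norm_add_le _ _
    _ < ε / 2 + ε / 2 := add_lt_add_of_lt_of_le h1 (h2.trans h4)
    _ = ε := add_halves ε

theorem continuous_displacement (H : IsBoundedControl S R b N) {u : ℝ → X} (hu : Continuous u) :
    Continuous fun t => displacement S R b (max t 0) u := by
  have h : ContinuousOn (fun t => displacement S R b t u) (Set.Ici 0) := by
    rw [Metric.continuousOn_iff]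
    intro t₀ ht₀ ε hε
    obtain ⟨η, hη, key⟩ := H.exists_norm_displacement_sub_lt hu (t₀ + 1) hε
    refine ⟨min η 1, by positivity, fun t ht htt => ?_⟩
    rw [Real.dist_eq, lt_min_iff] at htt
    rw [dist_eq_norm]
    rcases le_total t t₀ with hle | hle
    · rw [abs_sub_comm, abs_of_nonneg (sub_nonneg.2 hle)] at htt
      have := key t (t₀ - t) ht (by linarith) (by linarith) htt.1
      rw [norm_sub_rev]
      simpa using this
    · rw [abs_of_nonneg (sub_nonneg.2 hle)] at htt
      have := key t₀ (t - t₀) ht₀ (by linarith) (by linarith) htt.1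
      simpa using this
  exact h.comp_continuous (by fun_prop) fun t => Set.mem_Ici.2 (le_max_right _ _)

/-- The operator `v ↦ e^{-t} R⁻¹ ∫₀ᵗ S(t - s) b (eˢ v(s)) ds` on bounded continuous functions. The
functions live on `ℝ` for convenience: negative times are cut off. -/
def volterra (H : IsBoundedControl S R b N) :
    BoundedContinuousFunction ℝ X →L[𝕜] BoundedContinuousFunction ℝ X :=
  LinearMap.mkContinuous
    { toFun := fun v => BoundedContinuousFunction.ofNormedAddCommGroup
        (fun t => Real.exp (-max t 0) • displacement S R b (max t 0) (fun s => Real.exp s • v s))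
        ((by fun_prop : Continuous fun t : ℝ => Real.exp (-max t 0)).smul
          (H.continuous_displacement (by fun_prop))) (N * ‖v‖) (H.norm_exp_smul_displacement_le v)
      map_add' := fun v w => by
        ext t
        simp only [BoundedContinuousFunction.coe_ofNormedAddCommGroup,
          BoundedContinuousFunction.coe_add, Pi.add_apply, ← smul_add]
        congr 1
        have hv : Continuous fun s => Real.exp s • v s := by fun_prop
        have hw : Continuous fun s => Real.exp s • w s := by fun_prop
        refine H.displacement_eq ?_
        rw [map_add, H.map_displacement (le_max_right _ _) hv,
          H.map_displacement (le_max_right _ _) hw, ← duhamel_fun_add H.contractive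
            (le_max_right _ _) (hv.intervalIntegrable _ _) (hw.intervalIntegrable _ _)]
        simp only [smul_add]
      map_smul' := fun c v => by
        ext t
        have : SMulCommClass ℝ 𝕜 X := inferInstance
        simp only [BoundedContinuousFunction.coe_ofNormedAddCommGroup,
          BoundedContinuousFunction.coe_smul, RingHom.id_apply]
        rw [smul_comm c]
        congr 1
        have hv : Continuous fun s => Real.exp s • v s := by fun_prop
        refine H.displacement_eq ?_
        rw [map_smul, H.map_displacement (le_max_right _ _) hv, ← duhamel_fun_smul]
        simp only [smul_comm c] }
    N fun v => BoundedContinuousFunction.norm_ofNormedAddCommGroup_le _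
      (mul_nonneg H.nonneg (norm_nonneg v)) (H.norm_exp_smul_displacement_le v)

theorem volterra_apply (H : IsBoundedControl S R b N) (v : BoundedContinuousFunction ℝ X) {t : ℝ}
    (ht : 0 ≤ t) : H.volterra v t =
      Real.exp (-t) • displacement S R b t (fun s => Real.exp s • v s) := by
  change Real.exp (-max t 0) • displacement S R b (max t 0) _ = _
  rw [max_eq_left ht]

theorem norm_volterra_le (H : IsBoundedControl S R b N) : ‖H.volterra‖ ≤ N :=
  ContinuousLinearMap.opNorm_le_bound _ H.nonneg fun v =>
    BoundedContinuousFunction.norm_ofNormedAddCommGroup_le _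
      (mul_nonneg H.nonneg (norm_nonneg v)) (H.norm_exp_smul_displacement_le v)

/-- The perturbed orbits, by a Neumann series for `1 + ρ V` with the Volterra operator `V`. -/
theorem exists_perturbed_orbits (H : IsBoundedControl S R b N) {ρ : ℝ} (hρ : 0 ≤ ρ)
    (hρN : ρ * N ≤ 1 / 2) :
    ∃ P : ℝ → X →L[𝕜] X, (∀ x, Continuous fun t => P t x) ∧
      (∀ t, 0 ≤ t → ∀ x, P t x = S.op t x - ρ • displacement S R b t (fun s => P s x)) ∧
      ∀ t, 0 ≤ t → ∀ x, ‖P t x‖ ≤ 2 * Real.exp t * ‖x‖ := by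
  set V := H.volterra
  have hnorm : ‖-((ρ : 𝕜) • V)‖ ≤ 1 / 2 := by
    rw [norm_neg, norm_smul, RCLike.norm_ofReal, abs_of_nonneg hρ]
    exact (mul_le_mul_of_nonneg_left H.norm_volterra_le hρ).trans hρN
  have hlt : ‖-((ρ : 𝕜) • V)‖ < 1 := hnorm.trans_lt (by norm_num)
  set G := ((Units.oneSub _ hlt)⁻¹ : (BoundedContinuousFunction ℝ X →L[𝕜]
    BoundedContinuousFunction ℝ X)ˣ) with hG
  set F : X →L[𝕜] BoundedContinuousFunction ℝ X :=
    (G : BoundedContinuousFunction ℝ X →L[𝕜] BoundedContinuousFunction ℝ X).comp H.weightedOrbit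
    with hF
  have hFeq : ∀ x, F x = H.weightedOrbit x - (ρ : 𝕜) • V (F x) := by
    intro x
    have h1 : ((Units.oneSub _ hlt : (BoundedContinuousFunction ℝ X →L[𝕜]
        BoundedContinuousFunction ℝ X)ˣ) : BoundedContinuousFunction ℝ X →L[𝕜]
        BoundedContinuousFunction ℝ X) * (G : BoundedContinuousFunction ℝ X →L[𝕜]
        BoundedContinuousFunction ℝ X) = 1 := by
      rw [hG, Units.mul_inv]
    have h2 := DFunLike.congr_fun h1 (H.weightedOrbit x)
    rw [Units.val_oneSub] at h2
    have h3 : F x - (-((ρ : 𝕜) • V)) (F x) = H.weightedOrbit x := h2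
    rw [← h3]
    simp
  have hFle : ∀ x, ‖F x‖ ≤ 2 * ‖x‖ := by
    intro x
    have h1 : ‖F x‖ ≤ ‖x‖ + 1 / 2 * ‖F x‖ := by
      conv_lhs => rw [hFeq x, sub_eq_add_neg]
      refine (norm_add_le _ _).trans (add_le_add (H.norm_weightedOrbit_le x) ?_)
      exact (-((ρ : 𝕜) • V)).le_of_opNorm_le hnorm (F x)
    linarith
  refine ⟨fun t => (Real.exp t : 𝕜) • (BoundedContinuousFunction.evalCLM 𝕜 t).comp F,
    fun x => ?_, fun t ht x => ?_, fun t ht x => ?_⟩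
  · have h1 : Continuous fun t : ℝ => (Real.exp t : 𝕜) :=
      RCLike.continuous_ofReal.comp Real.continuous_exp
    exact h1.smul (F x).continuous
  · have hsm : ∀ (r : ℝ) (y : X), (r : 𝕜) • y = r • y := fun r y => by
      rw [← algebraMap_smul 𝕜 r y, RCLike.algebraMap_eq_ofReal]
    have h1 : F x t = Real.exp (-t) • S.op t x -
        ρ • Real.exp (-t) • displacement S R b t (fun s => Real.exp s • F x s) := by
      conv_lhs => rw [hFeq x]
      rw [← H.weightedOrbit_apply x ht, ← H.volterra_apply _ ht, ← hsm ρ]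
      rfl
    have h2 : ∀ s, ((Real.exp s : 𝕜) • (BoundedContinuousFunction.evalCLM 𝕜 s).comp F) x =
        Real.exp s • F x s := fun s => hsm _ _
    simp only [h2]
    conv_lhs => rw [h1]
    rw [smul_sub, smul_comm ρ, smul_smul, smul_smul, ← Real.exp_add]
    simp
  · change ‖(Real.exp t : 𝕜) • F x t‖ ≤ _
    rw [norm_smul, RCLike.norm_ofReal, Real.abs_exp]
    calc Real.exp t * ‖F x t‖ ≤ Real.exp t * (2 * ‖x‖) := by
          gcongr
          exact ((F x).norm_coe_le_norm t).trans (hFle x)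
      _ = 2 * Real.exp t * ‖x‖ := by ring

end IsBoundedControl

/-- `U` is the semigroup of the mild solutions of `x' = A x - ρ B x`, with the equation written in
`X` by means of the embedding `R`. The growth bound is the one that the Neumann series yields for
`ρ N ≤ 1 / 2`. The orbits are continuous on all of `ℝ`, for convenience: the values at negative
times carry no information. -/
structure IsPerturbedSemigroup (S : C0Semigroup 𝕜 X) (R b : X →L[𝕜] X) (ρ : ℝ)
    (U : C0Semigroup 𝕜 X) : Prop where
  continuous : ∀ x, Continuous fun t => U.op t x
  norm_le : ∀ t, 0 ≤ t → ∀ x, ‖U.op t x‖ ≤ 2 * Real.exp t * ‖x‖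
  eq : ∀ t, 0 ≤ t → ∀ x, U.op t x = S.op t x - ρ • displacement S R b t (fun s => U.op s x)
  map_eq : ∀ t, 0 ≤ t → ∀ x,
    R (U.op t x) = S.op t (R x) - ρ • duhamel S b t (fun s => U.op s x)

theorem IsBoundedControl.exists_isPerturbedSemigroup [CompleteSpace X] [IsScalarTower ℝ 𝕜 X]
    (H : IsBoundedControl S R b N) {ρ : ℝ} (hρ : 0 ≤ ρ) (hρN : ρ * N ≤ 1 / 2) :
    ∃ U : C0Semigroup 𝕜 X, IsPerturbedSemigroup S R b ρ U := by
  obtain ⟨P, hPc, hPe, hPle⟩ := H.exists_perturbed_orbits hρ hρN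
  have hPR : ∀ t, 0 ≤ t → ∀ x,
      R (P t x) = S.op t (R x) - ρ • duhamel S b t (fun s => P s x) := fun t ht x => by
    rw [hPe t ht x, map_sub, R.map_smul_of_tower, H.map_displacement ht (hPc x), H.comm t ht]
  have hP0 : ∀ x, P 0 x = x := fun x => H.injective <| by
    rw [hPR 0 le_rfl, S.op_zero_apply, duhamel_zero, smul_zero, sub_zero]
  let U : C0Semigroup 𝕜 X :=
    { op := P
      op_zero := ContinuousLinearMap.ext hP0
      -- Both sides are mild solutions with initial value `P t x`.
      op_add := fun s t hs ht => ContinuousLinearMap.ext fun x => by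
        have hc : Continuous fun r => P (r + t) x := (hPc x).comp (continuous_add_const t)
        refine H.eq_of_volterra_eq (f := fun r => S.op r (R (P t x))) hρ hρN hc (hPc (P t x))
          (fun r hr => ?_) (fun r hr => hPR r hr _) hs
        rw [hPR _ (add_nonneg hr ht), duhamel_add H.contractive hr ht
          ((hPc x).intervalIntegrable _ _), hPR t ht, map_sub, (S.op r).map_smul_of_tower,
          S.op_add_apply hr ht, smul_add]
        abel
      tendsto_zero := fun x => by
        have h := (hPc x).tendsto 0
        rw [hP0] at h
        exact h.mono_left nhdsWithin_le_nhds }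
  exact ⟨U, hPc, hPle, hPe, hPR⟩

end Perturbation

/-! ### The generator of the perturbed semigroup -/

section Generator

variable {𝕜 X : Type*} [RCLike 𝕜] [NormedAddCommGroup X] [NormedSpace 𝕜 X]

theorem C0Semigroup.intervalIntegrable_orbit {U : C0Semigroup 𝕜 X} {x : X}
    (hc : ContinuousOn (fun t => U.op t x) (Set.Ici 0)) {s t : ℝ} (hs : 0 ≤ s) (ht : 0 ≤ t) :
    IntervalIntegrable (fun r => U.op r x) volume s t := by
  refine (hc.mono fun r hr => ?_).intervalIntegrable
  rcases Set.mem_uIcc.1 hr with h | h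
  · exact hs.trans h.1
  · exact ht.trans h.1

variable [NormedSpace ℝ X]

theorem ofReal_inv_smul_eq [IsScalarTower ℝ 𝕜 X] (r : ℝ) (x : X) : ((r : 𝕜)⁻¹) • x = r⁻¹ • x := by
  rw [← algebraMap_smul 𝕜 r⁻¹ x, RCLike.algebraMap_eq_ofReal, RCLike.ofReal_inv]

theorem tendsto_inv_smul_integral [CompleteSpace X] {f : ℝ → X} (hf : Continuous f) :
    Tendsto (fun h : ℝ => h⁻¹ • ∫ s in (0 : ℝ)..h, f s) (𝓝[>] 0) (𝓝 (f 0)) := by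
  have h1 : HasDerivAt (fun h => ∫ s in (0 : ℝ)..h, f s) (f 0) 0 :=
    intervalIntegral.integral_hasDerivAt_right (hf.intervalIntegrable _ _)
      (hf.stronglyMeasurableAtFilter _ _) hf.continuousAt
  simpa using h1.tendsto_slope_zero_right

theorem C0Semigroup.op_integral_orbit [CompleteSpace X] {U : C0Semigroup 𝕜 X}
    {x : X} (hc : ContinuousOn (fun t => U.op t x) (Set.Ici 0)) {t h : ℝ} (ht : 0 ≤ t)
    (hh : 0 ≤ h) :
    U.op t (∫ s in (0 : ℝ)..h, U.op s x) = ∫ s in t..(t + h), U.op s x := by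
  rw [← ContinuousLinearMap.intervalIntegral_comp_comm _ (U.intervalIntegrable_orbit hc le_rfl hh)]
  have h1 := intervalIntegral.integral_comp_add_left (a := 0) (b := h) (fun s => U.op s x) t
  rw [add_zero] at h1
  rw [← h1]
  refine intervalIntegral.integral_congr fun s hs => ?_
  rw [Set.uIcc_of_le hh] at hs
  exact (U.op_add_apply ht hs.1 x).symm

theorem C0Semigroup.tendsto_inv_smul_integral_orbit [CompleteSpace X] {U : C0Semigroup 𝕜 X} {x : X}
    (hc : ContinuousOn (fun t => U.op t x) (Set.Ici 0)) :
    Tendsto (fun h : ℝ => h⁻¹ • ∫ s in (0 : ℝ)..h, U.op s x) (𝓝[>] 0) (𝓝 x) := by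
  have h1 : Continuous fun t : ℝ => U.op (max t 0) x :=
    hc.comp_continuous (by fun_prop) fun t => Set.mem_Ici.2 (le_max_right _ _)
  have h2 := tendsto_inv_smul_integral h1
  rw [max_self, U.op_zero_apply] at h2
  refine h2.congr' ?_
  filter_upwards [self_mem_nhdsWithin] with h hh
  congr 1
  refine intervalIntegral.integral_congr fun s hs => ?_
  rw [Set.uIcc_of_le (Set.mem_Ioi.1 hh).le] at hs
  simp only [max_eq_left hs.1]

/-- Means of orbits over short time intervals lie in the domain of the generator. -/
theorem C0Semigroup.tendsto_op_integral_orbit_sub [CompleteSpace X] [IsScalarTower ℝ 𝕜 X]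
    {U : C0Semigroup 𝕜 X} {x : X} (hc : ContinuousOn (fun t => U.op t x) (Set.Ici 0)) {h : ℝ}
    (hh : 0 ≤ h) :
    Tendsto (fun k : ℝ => k⁻¹ • (U.op k (∫ s in (0 : ℝ)..h, U.op s x) -
      ∫ s in (0 : ℝ)..h, U.op s x)) (𝓝[>] 0) (𝓝 (U.op h x - x)) := by
  have h1 := U.tendsto_inv_smul_integral_orbit hc
  have h2 : Tendsto (fun k : ℝ => U.op h (k⁻¹ • ∫ s in (0 : ℝ)..k, U.op s x) -
      k⁻¹ • ∫ s in (0 : ℝ)..k, U.op s x) (𝓝[>] 0) (𝓝 (U.op h x - x)) :=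
    (((U.op h).continuous.tendsto x).comp h1).sub h1
  refine h2.congr' ?_
  filter_upwards [self_mem_nhdsWithin] with k hk
  have hk0 : 0 ≤ k := (Set.mem_Ioi.1 hk).le
  rw [(U.op h).map_smul_of_tower, ← smul_sub,
    U.op_integral_orbit hc hh hk0, U.op_integral_orbit hc hk0 hh]
  congr 1
  have hi : ∀ a b : ℝ, 0 ≤ a → 0 ≤ b → IntervalIntegrable (fun r => U.op r x) volume a b :=
    fun a b ha hb => U.intervalIntegrable_orbit hc ha hb
  have e1 := intervalIntegral.integral_add_adjacent_intervals (hi 0 h le_rfl hh)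
    (hi h (h + k) hh (by positivity))
  have e2 := intervalIntegral.integral_add_adjacent_intervals (hi 0 k le_rfl hk0)
    (hi k (k + h) hk0 (by positivity))
  rw [add_comm k h] at e2 ⊢
  rw [sub_eq_sub_iff_add_eq_add]
  exact ((add_comm _ _).trans e1).trans (e2.symm.trans (add_comm _ _))

theorem C0Semigroup.IsGeneratedBy.dense_domain [CompleteSpace X] [IsScalarTower ℝ 𝕜 X]
    {U : C0Semigroup 𝕜 X} {A : X →ₗ.[𝕜] X} (hA : U.IsGeneratedBy A)
    (hc : ∀ x, ContinuousOn (fun t => U.op t x) (Set.Ici 0)) : Dense (A.domain : Set X) := by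
  intro x
  refine mem_closure_of_tendsto (U.tendsto_inv_smul_integral_orbit (hc x)) ?_
  filter_upwards [self_mem_nhdsWithin] with h hh
  rw [← ofReal_inv_smul_eq (𝕜 := 𝕜)]
  refine A.domain.smul_mem _ (LinearPMap.mem_domain_of_mem_graph ((hA _ (U.op h x - x)).2 ?_))
  simp only [ofReal_inv_smul_eq]
  exact U.tendsto_op_integral_orbit_sub (hc x) (Set.mem_Ioi.1 hh).le

variable {S : C0Semigroup 𝕜 X} {R b : X →L[𝕜] X} {N : ℝ}

/-- The Duhamel integral has the derivative `b (u 0)` at time `0`. -/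
theorem tendsto_inv_smul_duhamel [CompleteSpace X] (hS : S.IsContractive) {u : ℝ → X}
    (hu : Continuous u) :
    Tendsto (fun h : ℝ => h⁻¹ • duhamel S b h u) (𝓝[>] 0) (𝓝 (b (u 0))) := by
  have hF : Continuous fun z : ℝ × ℝ => S.op (max (z.1 - z.2) 0) (b (u z.2)) :=
    hS.continuous_uncurry.comp
      ((continuous_fst.sub continuous_snd).prodMk (b.continuous.comp (hu.comp continuous_snd)))
  have hF0 := hF.tendsto (0, 0)
  simp only [sub_self, max_self, S.op_zero_apply] at hF0
  rw [Metric.tendsto_nhds]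
  intro ε hε
  obtain ⟨δ, hδ, hball⟩ := Metric.eventually_nhds_iff.1
    ((Metric.tendsto_nhds.1 hF0) (ε / 2) (half_pos hε))
  filter_upwards [Ioo_mem_nhdsGT hδ] with h hh
  have hi := intervalIntegrable_duhamel (b := b) hS hh.1.le (hu.intervalIntegrable 0 h)
  have h1 : h⁻¹ • duhamel S b h u - b (u 0) =
      h⁻¹ • ∫ s in (0 : ℝ)..h, (S.op (h - s) (b (u s)) - b (u 0)) := by
    rw [intervalIntegral.integral_sub hi intervalIntegrable_const, intervalIntegral.integral_const,
      smul_sub, sub_zero, smul_smul, inv_mul_cancel₀ hh.1.ne', one_smul, duhamel]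
  have h2 : ‖∫ s in (0 : ℝ)..h, (S.op (h - s) (b (u s)) - b (u 0))‖ ≤ ε / 2 * |h - 0| := by
    refine intervalIntegral.norm_integral_le_of_norm_le_const fun s hs => ?_
    rw [Set.uIoc_of_le hh.1.le] at hs
    have h3 := hball (y := (h, s)) (by
      rw [Prod.dist_eq, max_lt_iff, Real.dist_eq, Real.dist_eq, sub_zero, sub_zero,
        abs_of_pos hh.1, abs_of_pos hs.1]
      exact ⟨hh.2, hs.2.trans_lt hh.2⟩)
    simp only [max_eq_left (sub_nonneg.2 hs.2)] at h3
    rw [← dist_eq_norm]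
    exact h3.le
  rw [dist_eq_norm, h1, norm_smul, norm_inv, Real.norm_eq_abs, abs_of_pos hh.1]
  rw [sub_zero, abs_of_pos hh.1] at h2
  rw [inv_mul_lt_iff₀ hh.1]
  nlinarith [hh.1]

variable [CompleteSpace X] [IsScalarTower ℝ 𝕜 X] {U : C0Semigroup 𝕜 X} {ρ : ℝ} {μ : 𝕜}

/-- The generator of the perturbed semigroup is contained in the part of `A₋₁ - ρ B` in `X`: apply
`R` to the difference quotients. -/
theorem IsPerturbedSemigroup.map_eq_of_tendsto (hS : S.IsContractive)
    (hgen : ∀ x, Tendsto (fun h : ℝ => h⁻¹ • (S.op h (R x) - R x)) (𝓝[>] 0) (𝓝 (μ • R x - x)))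
    (hU : IsPerturbedSemigroup S R b ρ U) {x y : X}
    (hxy : Tendsto (fun h : ℝ => h⁻¹ • (U.op h x - x)) (𝓝[>] 0) (𝓝 y)) :
    μ • R x - x - ρ • b x = R y := by
  have h1 := (tendsto_inv_smul_duhamel (b := b) hS (hU.continuous x)).const_smul ρ
  rw [U.op_zero_apply] at h1
  refine tendsto_nhds_unique (((hgen x).sub h1).congr' ?_) ((R.continuous.tendsto y).comp hxy)
  filter_upwards [self_mem_nhdsWithin] with h hh
  rw [Function.comp_apply, R.map_smul_of_tower, map_sub, hU.map_eq h (Set.mem_Ioi.1 hh).le,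
    smul_comm ρ, ← smul_sub]
  congr 1
  abel

/-- If `(A₋₁ - ρ B) x = y` in `X`, then `w(t) = x + ∫₀ᵗ U(s) y ds` is the perturbed orbit of `x`.
The defect `E` of the Volterra equation for `w` satisfies `E(t + h) = E(t) + S(t) E(h)` and
`E(h) = o(h)`, hence vanishes. -/
theorem IsPerturbedSemigroup.op_eq_add_integral (H : IsBoundedControl S R b N) (hρ : 0 ≤ ρ)
    (hρN : ρ * N ≤ 1 / 2)
    (hgen : ∀ x, Tendsto (fun h : ℝ => h⁻¹ • (S.op h (R x) - R x)) (𝓝[>] 0) (𝓝 (μ • R x - x)))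
    (hU : IsPerturbedSemigroup S R b ρ U) {x y : X} (hxy : μ • R x - x - ρ • b x = R y) {t : ℝ}
    (ht : 0 ≤ t) : U.op t x = x + ∫ s in (0 : ℝ)..t, U.op s y := by
  set I : ℝ → X := fun h => ∫ s in (0 : ℝ)..h, U.op s y with hI
  have hS := H.contractive
  have hcy := hU.continuous y
  have hIc : Continuous I := intervalIntegral.continuous_primitive
    (fun a b => hcy.intervalIntegrable a b) 0
  set w : ℝ → X := fun t => x + I t with hw
  have hwc : Continuous w := continuous_const.add hIc
  have hI0 : I 0 = 0 := by simp [hI]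
  have hIadd : ∀ t h : ℝ, 0 ≤ t → 0 ≤ h → I (t + h) = I t + U.op t (I h) := fun t h ht hh => by
    simp only [hI]
    rw [U.op_integral_orbit hcy.continuousOn ht hh, intervalIntegral.integral_add_adjacent_intervals
      (hcy.intervalIntegrable _ _) (hcy.intervalIntegrable _ _)]
  set E : ℝ → X := fun t => R (w t) + ρ • duhamel S b t w - S.op t (R x) with hE
  have hEadd : ∀ t h : ℝ, 0 ≤ t → 0 ≤ h → E (t + h) = E t + S.op t (E h) := by
    intro t h ht hh
    have h1 : duhamel S b t (fun s => w (s + h)) =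
        duhamel S b t w + duhamel S b t (fun s => U.op s (I h)) := by
      rw [← duhamel_fun_add hS ht (hwc.intervalIntegrable _ _)
        ((hU.continuous (I h)).intervalIntegrable _ _)]
      refine duhamel_congr ht fun s hs => ?_
      simp only [hw, hIadd s h hs.1 hh, add_assoc]
    -- The Duhamel integral of the perturbed orbit of `I h` is known from its Volterra equation.
    have h2 := hU.map_eq t ht (I h)
    simp only [hE, hw] at h1 ⊢
    rw [duhamel_add hS ht hh (hwc.intervalIntegrable _ _), h1, hIadd t h ht hh,
      S.op_add_apply ht hh]
    simp only [map_add, map_sub, smul_add, (S.op t).map_smul_of_tower]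
    rw [h2]
    abel
  have hElim : Tendsto (fun h : ℝ => h⁻¹ • E h) (𝓝[>] 0) (𝓝 0) := by
    have h1 : Tendsto (fun h : ℝ => h⁻¹ • I h) (𝓝[>] 0) (𝓝 y) :=
      U.tendsto_inv_smul_integral_orbit hcy.continuousOn
    have h2 := (tendsto_inv_smul_duhamel (b := b) hS hwc).const_smul ρ
    have h3 := (((R.continuous.tendsto y).comp h1).add h2).sub (hgen x)
    have h4 : R y + ρ • b (w 0) - (μ • R x - x) = 0 := by
      rw [← hxy]; simp [hw, hI0]
    rw [h4] at h3
    refine h3.congr fun h => ?_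
    simp only [hE, hw, Function.comp_apply, R.map_smul_of_tower, map_add, smul_sub, smul_add,
      smul_comm ρ]
    abel
  have hE0 : E 0 = 0 := by simp [hE, hw, hI0, duhamel_zero, S.op_zero_apply]
  have hEn : ∀ (n : ℕ) (h : ℝ), 0 ≤ h → ‖E (n * h)‖ ≤ n * ‖E h‖ := by
    intro n h hh
    induction n with
    | zero => simp [hE0]
    | succ n ih =>
      have h1 : ((n + 1 : ℕ) : ℝ) * h = h + n * h := by push_cast; ring
      rw [h1, hEadd h _ hh (by positivity)]
      refine (norm_add_le _ _).trans ?_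
      push_cast
      linarith [hS.norm_op_le hh (E (n * h))]
  -- `‖E t‖ ≤ n ‖E (t / n)‖ = t ‖(t / n)⁻¹ E (t / n)‖ → 0`
  have hEzero : ∀ t : ℝ, 0 ≤ t → E t = 0 := by
    intro t ht
    rcases ht.eq_or_lt with rfl | ht
    · exact hE0
    have h1 : Tendsto (fun n : ℕ => t / n) atTop (𝓝[>] 0) := by
      refine tendsto_nhdsWithin_iff.2 ⟨tendsto_const_div_atTop_nhds_zero_nat t, ?_⟩
      filter_upwards [eventually_gt_atTop 0] with n hn
      exact Set.mem_Ioi.2 (by positivity)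
    have h2 := ((hElim.comp h1).norm).const_mul t
    rw [norm_zero, mul_zero] at h2
    refine norm_le_zero_iff.1 (ge_of_tendsto h2 ?_)
    filter_upwards [eventually_gt_atTop 0] with n hn
    have hn' : (0 : ℝ) < n := by exact_mod_cast hn
    have h3 := hEn n (t / n) (by positivity)
    rw [mul_div_cancel₀ t hn'.ne'] at h3
    refine h3.trans_eq ?_
    rw [Function.comp_apply, norm_smul, norm_inv, Real.norm_eq_abs, abs_of_pos (by positivity)]
    field_simp
  have hwe : ∀ t, 0 ≤ t → R (w t) = S.op t (R x) - ρ • duhamel S b t w := fun t ht => by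
    have := hEzero t ht
    simp only [hE] at this
    rw [sub_eq_zero] at this
    exact eq_sub_of_add_eq this
  exact H.eq_of_volterra_eq hρ hρN (hU.continuous x) hwc (fun t ht => hU.map_eq t ht x) hwe ht

/-- The generator of the perturbed semigroup is the part of `A₋₁ - ρ B` in `X`, whose graph is
described by the equation on the right. -/
theorem IsPerturbedSemigroup.tendsto_iff (H : IsBoundedControl S R b N) (hρ : 0 ≤ ρ)
    (hρN : ρ * N ≤ 1 / 2)
    (hgen : ∀ x, Tendsto (fun h : ℝ => h⁻¹ • (S.op h (R x) - R x)) (𝓝[>] 0) (𝓝 (μ • R x - x)))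
    (hU : IsPerturbedSemigroup S R b ρ U) {x y : X} :
    Tendsto (fun h : ℝ => h⁻¹ • (U.op h x - x)) (𝓝[>] 0) (𝓝 y) ↔
      μ • R x - x - ρ • b x = R y := by
  refine ⟨hU.map_eq_of_tendsto H.contractive hgen, fun hxy => ?_⟩
  refine (U.tendsto_inv_smul_integral_orbit (hU.continuous y).continuousOn).congr' ?_
  filter_upwards [self_mem_nhdsWithin] with h hh
  rw [hU.op_eq_add_integral H hρ hρN hgen hxy (Set.mem_Ioi.1 hh).le, add_sub_cancel_left]

end Generator

/-! ### Energy estimate and exponential decay -/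

section Stability

/-- A semigroup that is bounded on `[0, T]` and strictly contractive at time `T` decays
exponentially. -/
theorem C0Semigroup.exists_exponential_bound {𝕜 X : Type*} [RCLike 𝕜] [NormedAddCommGroup X]
    [NormedSpace 𝕜 X] (U : C0Semigroup 𝕜 X) {T c q : ℝ} (hT : 0 < T) (hc : 0 < c)
    (hq : 0 < q) (hq1 : q < 1) (hUc : ∀ t, 0 ≤ t → t ≤ T → ∀ x, ‖U.op t x‖ ≤ c * ‖x‖)
    (hUq : ∀ x, ‖U.op T x‖ ≤ q * ‖x‖) :
    ∃ K σ : ℝ, 0 < K ∧ 0 < σ ∧ ∀ (t : ℝ) (x : X), 0 ≤ t →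
      ‖U.op t x‖ ≤ K * Real.exp (-σ * t) * ‖x‖ := by
  have hpow : ∀ (n : ℕ) (x : X), ‖U.op (n * T) x‖ ≤ q ^ n * ‖x‖ := by
    intro n
    induction n with
    | zero => intro x; simp [U.op_zero_apply]
    | succ n ih =>
      intro x
      have h1 : ((n + 1 : ℕ) : ℝ) * T = n * T + T := by push_cast; ring
      rw [h1, U.op_add_apply (by positivity) hT.le]
      calc _ ≤ q ^ n * ‖U.op T x‖ := ih _
        _ ≤ q ^ n * (q * ‖x‖) := by gcongr; exact hUq x
        _ = q ^ (n + 1) * ‖x‖ := by ring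
  have hlog : Real.log q < 0 := Real.log_neg hq hq1
  refine ⟨c / q, -Real.log q / T, by positivity, div_pos (by linarith) hT, fun t x ht => ?_⟩
  set n := ⌊t / T⌋₊ with hn
  have hn1 : n * T ≤ t := (le_div_iff₀ hT).1 (Nat.floor_le (by positivity))
  have hn2 : t / T < n + 1 := Nat.lt_floor_add_one _
  have hn3 : t - n * T ≤ T := by
    have := (div_lt_iff₀ hT).1 hn2
    linarith
  have h1 : t = (t - n * T) + n * T := by ring
  have h2 : q ^ n ≤ q⁻¹ * Real.exp (-(-Real.log q / T) * t) := by
    have e1 : q ^ n = Real.exp (Real.log q * n) := by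
      rw [← Real.rpow_def_of_pos hq, Real.rpow_natCast]
    have e2 : q⁻¹ = Real.exp (-Real.log q) := by rw [Real.exp_neg, Real.exp_log hq]
    rw [e1, e2, ← Real.exp_add]
    refine Real.exp_le_exp.2 ?_
    have e3 : -Real.log q + -(-Real.log q / T) * t = Real.log q * (t / T - 1) := by ring
    rw [e3]
    nlinarith
  conv_lhs => rw [h1]
  rw [U.op_add_apply (by linarith) (by positivity)]
  calc _ ≤ c * ‖U.op (n * T) x‖ := hUc _ (by linarith) hn3 _
    _ ≤ c * (q ^ n * ‖x‖) := by gcongr; exact hpow n x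
    _ ≤ c * (q⁻¹ * Real.exp (-(-Real.log q / T) * t) * ‖x‖) := by gcongr
    _ = _ := by ring

variable {𝕜 X : Type*} [RCLike 𝕜] [NormedAddCommGroup X] [InnerProductSpace 𝕜 X]

theorem re_inner_map_self_sub_le (C : X →L[𝕜] X) (u s : X) :
    RCLike.re (inner 𝕜 (C s) s) - RCLike.re (inner 𝕜 (C u) u) ≤
      ‖C‖ * (‖u‖ + ‖s‖) * ‖u - s‖ := by
  have h1 : inner 𝕜 (C s) s - inner 𝕜 (C u) u =
      inner 𝕜 (C (s - u)) s + inner 𝕜 (C u) (s - u) := by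
    rw [map_sub, inner_sub_left, inner_sub_right]; ring
  rw [← map_sub, h1]
  calc _ ≤ ‖inner 𝕜 (C (s - u)) s + inner 𝕜 (C u) (s - u)‖ := RCLike.re_le_norm _
    _ ≤ ‖C (s - u)‖ * ‖s‖ + ‖C u‖ * ‖s - u‖ :=
      (norm_add_le _ _).trans (add_le_add (norm_inner_le_norm _ _) (norm_inner_le_norm _ _))
    _ ≤ ‖C‖ * ‖s - u‖ * ‖s‖ + ‖C‖ * ‖u‖ * ‖s - u‖ := by
      gcongr <;> exact C.le_opNorm _
    _ = _ := by rw [norm_sub_rev s u]; ring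

variable [NormedSpace ℝ X]

/-- The energy inequality along a differentiable orbit. -/
theorem norm_sq_add_integral_le {z z' : ℝ → X} {φ : ℝ → ℝ} {T : ℝ} (hT : 0 ≤ T)
    (hz : Continuous z) (hφ : Continuous φ) (hder : ∀ t, 0 < t → HasDerivAt z (z' t) t)
    (hle : ∀ t, 0 < t → RCLike.re (inner 𝕜 (z' t) (z t)) ≤ -φ t) :
    ‖z T‖ ^ 2 + 2 * ∫ t in (0 : ℝ)..T, φ t ≤ ‖z 0‖ ^ 2 := by
  have h1 : ‖z T‖ ^ 2 - ‖z 0‖ ^ 2 ≤ ∫ t in (0 : ℝ)..T, -(2 * φ t) := by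
    refine intervalIntegral.sub_le_integral_of_hasDeriv_right_of_le (g := fun t => ‖z t‖ ^ 2)
      (g' := fun t => 2 * RCLike.re (inner 𝕜 (z' t) (z t))) hT (by fun_prop) (fun t ht => ?_)
      (Continuous.integrableOn_Icc (by fun_prop)) fun t ht => ?_
    · have h2 := (hder t ht.1).inner 𝕜 (hder t ht.1)
      have h3 := (RCLike.reCLM (K := 𝕜)).hasFDerivAt.comp_hasDerivAt t h2
      refine (h3.congr_deriv ?_).hasDerivWithinAt.congr (fun s _ => ?_) ?_
      · simp only [RCLike.reCLM_apply, map_add]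
        rw [inner_re_symm]; ring
      · simp
      · simp
    · linarith [hle t ht.1]
  rw [intervalIntegral.integral_neg, intervalIntegral.integral_const_mul] at h1
  linarith

variable {S U : C0Semigroup 𝕜 X} {R b : X →L[𝕜] X} {N ρ : ℝ} {μ : 𝕜}

theorem IsPerturbedSemigroup.norm_op_sub_op_le (H : IsBoundedControl S R b N) (hρ : 0 ≤ ρ)
    (hU : IsPerturbedSemigroup S R b ρ U) {t : ℝ} (ht : 0 ≤ t) (x : X) :
    ‖U.op t x - S.op t x‖ ≤ ρ * (2 * N * Real.exp t * ‖x‖) := by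
  have h1 : U.op t x - S.op t x = -(ρ • displacement S R b t (fun s => U.op s x)) := by
    rw [hU.eq t ht x]; abel
  rw [h1, norm_neg, norm_smul, Real.norm_eq_abs, abs_of_nonneg hρ]
  refine mul_le_mul_of_nonneg_left ?_ hρ
  refine (H.norm_displacement_le ht (hU.continuous x) (m := 2 * ‖x‖) fun s hs => ?_).trans_eq
    (by ring)
  exact (hU.norm_le s hs.1 x).trans_eq (by ring)

variable [CompleteSpace X] [IsScalarTower ℝ 𝕜 X]

/-- The energy inequality for the perturbed semigroup, on the domain of its generator. -/
theorem IsPerturbedSemigroup.norm_sq_add_le (H : IsBoundedControl S R b N) (hρ : 0 ≤ ρ)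
    (hρN : ρ * N ≤ 1 / 2)
    (hgen : ∀ x, Tendsto (fun h : ℝ => h⁻¹ • (S.op h (R x) - R x)) (𝓝[>] 0) (𝓝 (μ • R x - x)))
    (hU : IsPerturbedSemigroup S R b ρ U) {C : X →L[𝕜] X}
    (hdiss : ∀ x y, μ • R x - x - ρ • b x = R y →
      RCLike.re (inner 𝕜 y x) ≤ -(ρ * RCLike.re (inner 𝕜 (C x) x)))
    {T : ℝ} (hT : 0 ≤ T) {x y : X} (hxy : μ • R x - x - ρ • b x = R y) :
    ‖U.op T x‖ ^ 2 + 2 * ρ * ∫ t in (0 : ℝ)..T, RCLike.re (inner 𝕜 (C (U.op t x)) (U.op t x)) ≤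
      ‖x‖ ^ 2 := by
  have hcx := hU.continuous x
  have hcy := hU.continuous y
  have hinner : Continuous fun t => RCLike.re (inner 𝕜 (C (U.op t x)) (U.op t x)) :=
    RCLike.continuous_re.comp ((C.continuous.comp hcx).inner hcx)
  have hder : ∀ t, 0 < t → HasDerivAt (fun t => U.op t x) (U.op t y) t := by
    intro t ht
    have h1 : HasDerivAt (fun t => x + ∫ s in (0 : ℝ)..t, U.op s y) (U.op t y) t :=
      (intervalIntegral.integral_hasDerivAt_right (hcy.intervalIntegrable _ _)
        (hcy.stronglyMeasurableAtFilter _ _) hcy.continuousAt).const_add x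
    refine h1.congr_of_eventuallyEq ?_
    filter_upwards [lt_mem_nhds ht] with s hs
    exact hU.op_eq_add_integral H hρ hρN hgen hxy hs.le
  have hlim := (hU.tendsto_iff H hρ hρN hgen).2 hxy
  have h := norm_sq_add_integral_le (𝕜 := 𝕜) (φ := fun t =>
    ρ * RCLike.re (inner 𝕜 (C (U.op t x)) (U.op t x))) hT hcx (by fun_prop) hder fun t ht => by
      refine hdiss _ _ ((hU.tendsto_iff H hρ hρN hgen).1 ?_)
      refine (((U.op t).continuous.tendsto y).comp hlim).congr' ?_
      filter_upwards [self_mem_nhdsWithin] with h hh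
      have hh0 := (Set.mem_Ioi.1 hh).le
      rw [Function.comp_apply, (U.op t).map_smul_of_tower, map_sub,
        ← U.op_add_apply ht.le hh0, ← U.op_add_apply hh0 ht.le, add_comm]
  rw [intervalIntegral.integral_const_mul, ← mul_assoc, U.op_zero_apply] at h
  exact h

/-- The decay over one period, from the energy inequality and the observability estimate for the
unperturbed semigroup: the perturbed and the unperturbed orbits differ by `O(ρ)`. -/
theorem IsPerturbedSemigroup.norm_sq_op_le (H : IsBoundedControl S R b N) (hρ : 0 ≤ ρ)
    (hρ1 : ρ ≤ 1) (hρN : ρ * N ≤ 1 / 2)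
    (hgen : ∀ x, Tendsto (fun h : ℝ => h⁻¹ • (S.op h (R x) - R x)) (𝓝[>] 0) (𝓝 (μ • R x - x)))
    (hU : IsPerturbedSemigroup S R b ρ U) {C : X →L[𝕜] X}
    (hdiss : ∀ x y, μ • R x - x - ρ • b x = R y →
      RCLike.re (inner 𝕜 y x) ≤ -(ρ * RCLike.re (inner 𝕜 (C x) x)))
    {T δ : ℝ} (hT : 0 ≤ T) (hδ : 0 ≤ δ)
    (hobs : ∀ x, δ * ‖S.op T x‖ ^ 2 ≤
      ∫ t in (0 : ℝ)..T, RCLike.re (inner 𝕜 (C (S.op t x)) (S.op t x))) (x : X) :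
    (1 + ρ * δ) * ‖U.op T x‖ ^ 2 ≤
      (1 + (2 * (‖C‖ * (2 * Real.exp T + 1) * (2 * N * Real.exp T) * T) +
        2 * δ * (2 * N * Real.exp T) ^ 2) * ρ ^ 2) * ‖x‖ ^ 2 := by
  set c := 2 * Real.exp T with hc
  set a := 2 * N * Real.exp T with ha
  have hN := H.nonneg
  have ha0 : 0 ≤ a := by positivity
  have hc0 : 0 ≤ c := by positivity
  have hS := H.contractive
  have hmain : ∀ x y : X, μ • R x - x - ρ • b x = R y → (1 + ρ * δ) * ‖U.op T x‖ ^ 2 ≤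
      (1 + (2 * (‖C‖ * (c + 1) * a * T) + 2 * δ * a ^ 2) * ρ ^ 2) * ‖x‖ ^ 2 := by
    intro x y hxy
    have hen := hU.norm_sq_add_le H hρ hρN hgen hdiss hT hxy
    have hdiff : ∀ t ∈ Set.Icc 0 T, ‖U.op t x - S.op t x‖ ≤ ρ * (a * ‖x‖) := fun t ht => by
      refine (hU.norm_op_sub_op_le H hρ ht.1 x).trans ?_
      rw [ha]
      gcongr
      exact ht.2
    have hcS : ContinuousOn (fun t => RCLike.re (inner 𝕜 (C (S.op t x)) (S.op t x)))
        (Set.uIcc 0 T) := by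
      rw [Set.uIcc_of_le hT]
      have h1 := (hS.continuousOn_orbit x).mono fun t (ht : t ∈ Set.Icc 0 T) => ht.1
      exact RCLike.continuous_re.comp_continuousOn ((C.continuous.comp_continuousOn h1).inner h1)
    have hcU : Continuous fun t => RCLike.re (inner 𝕜 (C (U.op t x)) (U.op t x)) :=
      RCLike.continuous_re.comp ((C.continuous.comp (hU.continuous x)).inner (hU.continuous x))
    have hint : (∫ t in (0 : ℝ)..T, RCLike.re (inner 𝕜 (C (S.op t x)) (S.op t x))) -
        (∫ t in (0 : ℝ)..T, RCLike.re (inner 𝕜 (C (U.op t x)) (U.op t x))) ≤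
        T * (‖C‖ * (c + 1) * a * ρ * ‖x‖ ^ 2) := by
      rw [← intervalIntegral.integral_sub hcS.intervalIntegrable (hcU.intervalIntegrable _ _)]
      calc _ ≤ ∫ _ in (0 : ℝ)..T, ‖C‖ * (c + 1) * a * ρ * ‖x‖ ^ 2 := by
            refine intervalIntegral.integral_mono_on hT
              (hcS.intervalIntegrable.sub (hcU.intervalIntegrable _ _))
              intervalIntegrable_const fun t ht => ?_
            refine (re_inner_map_self_sub_le C (U.op t x) (S.op t x)).trans ?_
            calc _ ≤ ‖C‖ * (c * ‖x‖ + ‖x‖) * (ρ * (a * ‖x‖)) := by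
                  gcongr
                  · refine (hU.norm_le t ht.1 x).trans ?_
                    rw [hc]
                    gcongr
                    exact ht.2
                  · exact hS.norm_op_le ht.1 x
                  · exact hdiff t ht
              _ = _ := by ring
        _ = _ := by rw [intervalIntegral.integral_const]; simp
    have hsq : ‖U.op T x‖ ^ 2 ≤ 2 * ‖S.op T x‖ ^ 2 + 2 * (ρ * (a * ‖x‖)) ^ 2 := by
      have h1 : ‖U.op T x‖ ≤ ‖S.op T x‖ + ρ * (a * ‖x‖) := by
        have := norm_add_le (S.op T x) (U.op T x - S.op T x)
        rw [add_sub_cancel] at this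
        linarith [hdiff T ⟨hT, le_rfl⟩]
      calc ‖U.op T x‖ ^ 2 ≤ (‖S.op T x‖ + ρ * (a * ‖x‖)) ^ 2 := by gcongr
        _ ≤ _ := by nlinarith [sq_nonneg (‖S.op T x‖ - ρ * (a * ‖x‖))]
    have h1 := mul_le_mul_of_nonneg_left hint (by positivity : 0 ≤ 2 * ρ)
    have h2 := mul_le_mul_of_nonneg_left (hobs x) (by positivity : 0 ≤ 2 * ρ)
    have h3 := mul_le_mul_of_nonneg_left hsq (by positivity : 0 ≤ ρ * δ)
    -- Here `ρ ≤ 1` turns the term of order `ρ³` into one of order `ρ²`.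
    have h4 : ρ ^ 3 * (δ * a ^ 2 * ‖x‖ ^ 2) ≤ ρ ^ 2 * (δ * a ^ 2 * ‖x‖ ^ 2) :=
      mul_le_mul_of_nonneg_right (pow_le_pow_of_le_one hρ hρ1 (by norm_num)) (by positivity)
    linarith
  -- The domain of the generator contains the means of the orbits, hence is dense.
  have hlim := U.tendsto_inv_smul_integral_orbit (hU.continuous x).continuousOn
  refine le_of_tendsto_of_tendsto
    (((((U.op T).continuous.tendsto x).comp hlim).norm.pow 2).const_mul (1 + ρ * δ))
    ((hlim.norm.pow 2).const_mul _) ?_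
  filter_upwards [self_mem_nhdsWithin] with h hh
  refine hmain _ (h⁻¹ • (U.op h x - x)) ?_
  have h1 := (hU.tendsto_iff H hρ hρN hgen).1
    (U.tendsto_op_integral_orbit_sub (hU.continuous x).continuousOn (Set.mem_Ioi.1 hh).le)
  rw [R.map_smul_of_tower, R.map_smul_of_tower, b.map_smul_of_tower, ← h1, smul_sub, smul_sub,
    smul_comm ρ, smul_comm μ]

/-- Exponential stability of the perturbed semigroups for all small gains `ρ`. -/
theorem IsBoundedControl.exists_exponentially_stable (H : IsBoundedControl S R b N)
    (hgen : ∀ x, Tendsto (fun h : ℝ => h⁻¹ • (S.op h (R x) - R x)) (𝓝[>] 0) (𝓝 (μ • R x - x)))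
    {C : X →L[𝕜] X} {ρ₀ : ℝ} (hρ₀ : 0 < ρ₀)
    (hdiss : ∀ ρ : ℝ, 0 < ρ → ρ < ρ₀ → ∀ x y, μ • R x - x - ρ • b x = R y →
      RCLike.re (inner 𝕜 y x) ≤ -(ρ * RCLike.re (inner 𝕜 (C x) x)))
    {T δ : ℝ} (hT : 0 < T) (hδ : 0 < δ)
    (hobs : ∀ x, δ * ‖S.op T x‖ ^ 2 ≤
      ∫ t in (0 : ℝ)..T, RCLike.re (inner 𝕜 (C (S.op t x)) (S.op t x))) :
    ∃ ρ₁ : ℝ, 0 < ρ₁ ∧ ∀ ρ : ℝ, 0 < ρ → ρ < ρ₁ → ρ * N ≤ 1 / 2 ∧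
      ∀ U : C0Semigroup 𝕜 X, IsPerturbedSemigroup S R b ρ U →
        ∃ K σ : ℝ, 0 < K ∧ 0 < σ ∧ ∀ (t : ℝ) (x : X), 0 ≤ t →
          ‖U.op t x‖ ≤ K * Real.exp (-σ * t) * ‖x‖ := by
  set κ := 2 * (‖C‖ * (2 * Real.exp T + 1) * (2 * N * Real.exp T) * T) +
    2 * δ * (2 * N * Real.exp T) ^ 2 with hκ
  have hN := H.nonneg
  have hκ0 : 0 ≤ κ := by positivity
  -- The last bound gives `κ ρ² < ρ δ`, so that the factor in `norm_sq_op_le` is less than `1`.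
  refine ⟨min (min ρ₀ 1) (min (1 / (2 * (N + 1))) (δ / (κ + 1))), by positivity,
    fun ρ hρ hlt => ?_⟩
  simp only [lt_min_iff] at hlt
  obtain ⟨⟨hlt0, hlt1⟩, hltN, hltκ⟩ := hlt
  have hρN : ρ * N ≤ 1 / 2 := by
    rw [lt_div_iff₀ (by positivity)] at hltN
    nlinarith
  have hρκ : κ * ρ ^ 2 < ρ * δ := by
    rw [lt_div_iff₀ (by positivity)] at hltκ
    nlinarith
  refine ⟨hρN, fun U hU => ?_⟩
  have hq0 : 0 < (1 + κ * ρ ^ 2) / (1 + ρ * δ) := by positivity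
  have hq1 : (1 + κ * ρ ^ 2) / (1 + ρ * δ) < 1 := (div_lt_one (by positivity)).2 (by linarith)
  refine U.exists_exponential_bound (c := 2 * Real.exp T) hT (by positivity)
    (Real.sqrt_pos.2 hq0) ((Real.sqrt_lt' one_pos).2 (by simpa using hq1))
    (fun t ht htT x => ?_) fun x => ?_
  · refine (hU.norm_le t ht x).trans ?_
    gcongr
  · have h1 := hU.norm_sq_op_le H hρ.le hlt1.le hρN hgen (hdiss ρ hρ hlt0) hT.le hδ.le hobs x
    refine le_of_sq_le_sq ?_ (by positivity)
    rw [mul_pow, Real.sq_sqrt hq0.le, div_mul_eq_mul_div, le_div_iff₀ (by positivity), mul_comm]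
    exact h1

end Stability

/-! ### Passage between the extrapolation space and the state space -/

section Transport

variable {𝕜 X : Type*} [RCLike 𝕜] [NormedAddCommGroup X]

section NormedSpace

variable [NormedSpace 𝕜 X] {S : C0Semigroup 𝕜 X} {A : X →ₗ.[𝕜] X} {μ : 𝕜}

theorem tendsto_resolvent_orbit [NormedSpace ℝ X] [IsScalarTower ℝ 𝕜 X]
    (hA : S.IsGeneratedBy A) (hμ : μ ∈ resolventSet A) (x : X) :
    Tendsto (fun h : ℝ => h⁻¹ • (S.op h (resolvent A μ x) - resolvent A μ x)) (𝓝[>] 0)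
      (𝓝 (μ • resolvent A μ x - x)) := by
  obtain ⟨hmem, hx⟩ := (isResolventAt_resolvent hμ).2 x
  have h1 := (hA _ _).1 (A.mem_graph ⟨resolvent A μ x, hmem⟩)
  simp only [ofReal_inv_smul_eq] at h1
  rwa [← sub_eq_iff_eq_add.2 (sub_eq_iff_eq_add'.1 hx)] at h1

variable [CompleteSpace X]

theorem extendOfNorm_resolvent_incl (A : X →ₗ.[𝕜] X) (μ : 𝕜) (x : X) :
    (resolvent A μ).toLinearMap.extendOfNorm (incl A μ).toLinearMap (incl A μ x) =
      resolvent A μ x :=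
  LinearMap.extendOfNorm_eq (f := (resolvent A μ).toLinearMap) (e := (incl A μ).toLinearMap)
    (denseRange_incl A μ) ⟨1, fun z => by
      change ‖resolvent A μ z‖ ≤ 1 * ‖incl A μ z‖
      rw [norm_incl, one_mul]⟩ x

/-- The extension of the resolvent `(μ I - A)⁻¹` to an isometry of `X₋₁` into `X`. -/
def extrapResolvent (A : X →ₗ.[𝕜] X) (μ : 𝕜) : Extrap A μ →ₗᵢ[𝕜] X where
  toLinearMap :=
    ((resolvent A μ).toLinearMap.extendOfNorm (incl A μ).toLinearMap).toLinearMap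
  norm_map' := fun z => by
    refine (denseRange_incl A μ).induction_on z
      (isClosed_eq ((ContinuousLinearMap.continuous _).norm) continuous_norm) fun x => ?_
    rw [norm_incl]
    exact congrArg norm (extendOfNorm_resolvent_incl A μ x)

theorem extrapResolvent_incl (A : X →ₗ.[𝕜] X) (μ : 𝕜) (x : X) :
    extrapResolvent A μ (incl A μ x) = resolvent A μ x :=
  extendOfNorm_resolvent_incl A μ x

theorem extrapResolvent_extrapSemigroup (hA : S.IsGeneratedBy A) (hμ : μ ∈ resolventSet A) {t : ℝ}
    (ht : 0 ≤ t) (z : Extrap A μ) :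
    extrapResolvent A μ (extrapSemigroup S A μ t z) = S.op t (extrapResolvent A μ z) := by
  refine (denseRange_incl A μ).induction_on z (isClosed_eq
    ((extrapResolvent A μ).continuous.comp (extrapSemigroup S A μ t).continuous)
    ((S.op t).continuous.comp (extrapResolvent A μ).continuous)) fun x => ?_
  rw [extrapSemigroup_incl hA hμ ht, extrapResolvent_incl, extrapResolvent_incl,
    resolvent_op_comm hA hμ ht]

theorem extrapResolvent_extrapGen (hμ : μ ∈ resolventSet A) (hA : Dense (A.domain : Set X))
    (x : X) : extrapResolvent A μ (extrapGen A μ x) = μ • resolvent A μ x - x := by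
  have h : Set.EqOn (fun x => extrapResolvent A μ (extrapGen A μ x))
      (fun x => μ • resolvent A μ x - x) (A.domain : Set X) := fun x hx => by
    have h1 := extrapGen_apply hμ hA ⟨x, hx⟩
    have h2 := (isResolventAt_resolvent hμ).1 ⟨x, hx⟩
    simp only at h1 h2 ⊢
    rw [map_sub, map_smul] at h2
    rw [h1, extrapResolvent_incl, eq_sub_iff_add_eq, ← sub_eq_iff_eq_add'.1 h2]
  exact congrFun (Continuous.ext_on hA
    ((extrapResolvent A μ).continuous.comp (extrapGen A μ).continuous)
    (((resolvent A μ).continuous.const_smul μ).sub continuous_id) h) x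

variable [NormedSpace ℝ X] {B : X →L[𝕜] Extrap A μ}

/-- The control operator `B`, followed by the isometry `extrapResolvent` of `X₋₁` into `X`. -/
def resolventControl (B : X →L[𝕜] Extrap A μ) : X →L[𝕜] X :=
  (extrapResolvent A μ).toContinuousLinearMap.comp B

theorem extrapResolvent_integral (hA : S.IsGeneratedBy A) (hμ : μ ∈ resolventSet A) {t : ℝ}
    (ht : 0 ≤ t) (u : ℝ → X) :
    extrapResolvent A μ (∫ s in (0 : ℝ)..t, extrapSemigroup S A μ (t - s) (B (u s))) =
      duhamel S (resolventControl B) t u := by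
  rw [duhamel, intervalIntegral.integral_of_le ht, intervalIntegral.integral_of_le ht,
    ← LinearIsometry.integral_comp_comm]
  refine setIntegral_congr_fun measurableSet_Ioc fun s hs => ?_
  exact extrapResolvent_extrapSemigroup hA hμ (sub_nonneg.2 hs.2) _

variable [IsScalarTower ℝ 𝕜 X]

theorem extrapResolvent_real_smul (r : ℝ) (z : Extrap A μ) :
    extrapResolvent A μ (r • z) = r • extrapResolvent A μ z :=
  (extrapResolvent A μ).toLinearMap.map_smul_of_tower r z

theorem mem_graph_part_iff (hμ : μ ∈ resolventSet A) (hA : Dense (A.domain : Set X)) (ρ : ℝ)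
    (x y : X) : (x, y) ∈ (part A μ (extrapGen A μ - (ρ : 𝕜) • B)).graph ↔
      μ • resolvent A μ x - x - ρ • resolventControl B x = resolvent A μ y := by
  rw [mem_graph_part hμ, ← (extrapResolvent A μ).injective.eq_iff, extrapResolvent_incl,
    ← extrapResolvent_extrapGen hμ hA, ← algebraMap_smul 𝕜 ρ (resolventControl B x),
    RCLike.algebraMap_eq_ofReal, sub_apply, map_sub, smul_apply, map_smul]
  rfl

theorem isMildSolution_iff (hA : S.IsGeneratedBy A) (hμ : μ ∈ resolventSet A) {ρ : ℝ} {x₀ : X}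
    {x : ℝ → X} : IsMildSolution S A μ B ρ x₀ x ↔ ContinuousOn x (Set.Ici 0) ∧ ∀ t, 0 ≤ t →
      resolvent A μ (x t) =
        S.op t (resolvent A μ x₀) - ρ • duhamel S (resolventControl B) t x := by
  refine and_congr_right fun _ => forall₂_congr fun t ht => ?_
  rw [← (extrapResolvent A μ).injective.eq_iff, map_sub, extrapResolvent_incl,
    extrapResolvent_incl, resolvent_op_comm hA hμ ht, ← extrapResolvent_integral hA hμ ht,
    extrapResolvent_real_smul]

theorem IsPAdmissible.exists_isBoundedControl (hS : S.IsContractive) (hA : S.IsGeneratedBy A)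
    (hμ : μ ∈ resolventSet A) {p : ℝ} (hp : 1 < p) (hB : IsPAdmissible S A μ B p) :
    ∃ N, IsBoundedControl S (resolvent A μ) (resolventControl B) N := by
  obtain ⟨T, hT, hadm⟩ := hB
  have hinj := resolvent_injective hμ
  obtain ⟨c, hc, hshort⟩ := exists_short_time_bound hS hinj hp hT.le fun u hu => by
    obtain ⟨y, hy⟩ := hadm u hu
    exact ⟨y, by rw [← extrapResolvent_integral hA hμ hT.le, ← hy, extrapResolvent_incl]⟩
  have hcomm : ∀ t : ℝ, 0 ≤ t → ∀ x, resolvent A μ (S.op t x) = S.op t (resolvent A μ x) :=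
    fun t ht x => resolvent_op_comm hA hμ ht x
  obtain ⟨N, hN, hbound⟩ := exists_global_bound hS hcomm hT
    (by positivity : 0 ≤ c * T ^ (1 / p)) fun h hh hhT u m hu hm => by
      obtain ⟨y, hy, hle⟩ := hshort h hh hhT u m hu hm
      have hm0 : 0 ≤ m := (norm_nonneg _).trans (hm 0 ⟨le_rfl, hh⟩)
      exact ⟨y, hy, hle.trans (by gcongr)⟩
  exact ⟨N, hS, hinj, hcomm, hN, hbound, T, hT, c, hc, 1 / p, by positivity, hshort⟩

theorem IsPerturbedSemigroup.isGeneratedBy_part (hA : S.IsGeneratedBy A)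
    (hμ : μ ∈ resolventSet A) {N ρ : ℝ} {U : C0Semigroup 𝕜 X}
    (H : IsBoundedControl S (resolvent A μ) (resolventControl B) N) (hρ : 0 ≤ ρ)
    (hρN : ρ * N ≤ 1 / 2)
    (hU : IsPerturbedSemigroup S (resolvent A μ) (resolventControl B) ρ U) :
    U.IsGeneratedBy (part A μ (extrapGen A μ - (ρ : 𝕜) • B)) := fun x y => by
  rw [mem_graph_part_iff hμ (hA.dense_domain H.contractive.continuousOn_orbit),
    ← hU.tendsto_iff H hρ hρN (tendsto_resolvent_orbit hA hμ)]
  simp only [ofReal_inv_smul_eq]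

theorem IsPerturbedSemigroup.isMildSolution_iff (hA : S.IsGeneratedBy A)
    (hμ : μ ∈ resolventSet A) {N ρ : ℝ} {U : C0Semigroup 𝕜 X}
    (H : IsBoundedControl S (resolvent A μ) (resolventControl B) N) (hρ : 0 ≤ ρ)
    (hρN : ρ * N ≤ 1 / 2)
    (hU : IsPerturbedSemigroup S (resolvent A μ) (resolventControl B) ρ U) (x₀ : X) (x : ℝ → X) :
    IsMildSolution S A μ B ρ x₀ x ↔ ∀ t : ℝ, 0 ≤ t → x t = U.op t x₀ := by
  rw [RangeDecomposition.isMildSolution_iff hA hμ]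
  constructor
  · rintro ⟨hc, hx⟩ t ht
    have hc' : Continuous fun t => x (max t 0) :=
      hc.comp_continuous (by fun_prop) fun t => Set.mem_Ici.2 (le_max_right _ _)
    have h := H.eq_of_volterra_eq hρ hρN hc' (hU.continuous x₀) (fun t ht => ?_)
      (fun t ht => hU.map_eq t ht x₀) ht
    · simpa only [max_eq_left ht] using h
    · rw [duhamel_congr (v := x) ht fun s hs => by rw [max_eq_left hs.1], max_eq_left ht]
      exact hx t ht
  · refine fun hx => ⟨(hU.continuous x₀).continuousOn.congr fun t ht => hx t ht, fun t ht => ?_⟩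
    rw [duhamel_congr (v := fun s => U.op s x₀) ht fun s hs => hx s hs.1, hx t ht]
    exact hU.map_eq t ht x₀

end NormedSpace

/-! ### Components of an admissible decomposition -/

section Decomposition

/-- `projX` is the genuine projection on `i(X) + W`, where its junk value does not occur. -/
theorem sub_incl_projX_mem [NormedSpace 𝕜 X] {A : X →ₗ.[𝕜] X} {μ : 𝕜}
    {W : Submodule 𝕜 (Extrap A μ)} {z : Extrap A μ}
    (hz : z ∈ LinearMap.range (incl A μ).toLinearMap ⊔ W) :
    z - incl A μ (projX A μ W z) ∈ W := by
  obtain ⟨_, ⟨y, rfl⟩, w, hw, rfl⟩ := Submodule.mem_sup.1 hz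
  have h : ∃ y', (incl A μ).toLinearMap y + w - incl A μ y' ∈ W := ⟨y, by simpa using hw⟩
  rw [projX, dif_pos h]
  exact h.choose_spec

theorem projX_eq_of_sub_mem [NormedSpace 𝕜 X] {A : X →ₗ.[𝕜] X} {μ : 𝕜} (hμ : μ ∈ resolventSet A)
    {W : Submodule 𝕜 (Extrap A μ)} (hW : Disjoint (LinearMap.range (incl A μ).toLinearMap) W)
    {z : Extrap A μ} {y : X} (h : z - incl A μ y ∈ W) : projX A μ W z = y := by
  rw [← projX_eq hμ hW y h, add_sub_cancel]

variable [InnerProductSpace 𝕜 X] {A : X →ₗ.[𝕜] X} {μ : 𝕜} {B K : X →L[𝕜] Extrap A μ}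
  {W : Submodule 𝕜 (Extrap A μ)} {ρ : ℝ}

theorem IsAdmissibleDecomposition.apply_mem (hρ : 0 < ρ)
    (D : IsAdmissibleDecomposition A μ W K (-((ρ : 𝕜) • B))) (x : X) :
    B x ∈ LinearMap.range (incl A μ).toLinearMap ⊔ W := by
  have h := D.range_right x
  rw [neg_apply, smul_apply, neg_mem_iff] at h
  exact (Submodule.smul_mem_iff _ (RCLike.ofReal_ne_zero.2 hρ.ne')).1 h

/-- The `X`-component of `B` is bounded, as that of `-ρ B` is. -/
theorem IsAdmissibleDecomposition.exists_projX_eq (hμ : μ ∈ resolventSet A) (hρ : 0 < ρ)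
    (D : IsAdmissibleDecomposition A μ W K (-((ρ : 𝕜) • B))) :
    ∃ C : X →L[𝕜] X, ∀ x, C x = projX A μ W (B x) := by
  obtain ⟨L, hL⟩ := D.bounded
  have hρ' : (ρ : 𝕜) ≠ 0 := RCLike.ofReal_ne_zero.2 hρ.ne'
  refine ⟨-((ρ : 𝕜)⁻¹ • L), fun x => (projX_eq_of_sub_mem hμ D.direct ?_).symm⟩
  have h := W.smul_mem (-(ρ : 𝕜)⁻¹) (sub_incl_projX_mem (D.range_right x))
  rw [← hL] at h
  convert h using 1
  rw [neg_apply, neg_apply, smul_apply, smul_apply, map_neg, map_smul, smul_sub, smul_neg,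
    neg_smul, neg_smul, neg_neg, smul_smul, inv_mul_cancel₀ hρ', one_smul]

/-- On the domain of the part of `A₋₁ - ρ B`, only the `X`-components contribute to the energy
balance, and that of `A₋₁` is dissipative. -/
theorem IsAdmissibleDecomposition.re_inner_le (hμ : μ ∈ resolventSet A) (hρ : 0 < ρ)
    (D : IsAdmissibleDecomposition A μ W K (-((ρ : 𝕜) • B))) {x y : X}
    (hxy : (x, y) ∈ (part A μ (K - (ρ : 𝕜) • B)).graph) :
    RCLike.re (inner 𝕜 y x) ≤ -(ρ * RCLike.re (inner 𝕜 (projX A μ W (B x)) x)) := by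
  have hdom : x ∈ (part A μ (K + -((ρ : 𝕜) • B))).domain := by
    rw [← sub_eq_add_neg]
    exact LinearPMap.mem_domain_of_mem_graph hxy
  have h1 := D.dissipative x hdom
  have h2 : K x - (ρ : 𝕜) • B x = incl A μ y := (mem_graph_part hμ _ x y).1 hxy
  have h4 := W.smul_mem (ρ : 𝕜) (sub_incl_projX_mem (D.apply_mem hρ x))
  set k := projX A μ W (K x)
  set l := projX A μ W (B x)
  have h5 : k = y + (ρ : 𝕜) • l := by
    refine projX_eq_of_sub_mem hμ D.direct ?_
    convert h4 using 1
    rw [map_add, map_smul, ← h2, smul_sub]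
    abel
  rw [h5, inner_add_left, map_add, inner_smul_left, RCLike.conj_ofReal, RCLike.re_ofReal_mul] at h1
  linarith

end Decomposition

end Transport

end RangeDecomposition

end

open RangeDecomposition in
theorem theorem3 {𝕜 X : Type*} [RCLike 𝕜] [NormedAddCommGroup X] [InnerProductSpace 𝕜 X]
    [CompleteSpace X]
    (S : C0Semigroup 𝕜 X) (hcontr : S.IsContractive)
    (A : X →ₗ.[𝕜] X) (hA : S.IsGeneratedBy A)
    (μ : 𝕜) (hμ : μ ∈ resolventSet A)
    (B : X →L[𝕜] Extrap A μ)
    (W : Submodule 𝕜 (Extrap A μ))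
    (hW : ∃ ρ₀ : ℝ, 0 < ρ₀ ∧ ∀ ρ : ℝ, 0 < ρ → ρ < ρ₀ →
      IsAdmissibleDecomposition A μ W (extrapGen A μ) (-((ρ : 𝕜) • B)))
    (p : ℝ) (hp : 1 < p) (hB : IsPAdmissible S A μ B p)
    (T δ : ℝ) (hT : 0 < T) (hδ : 0 < δ)
    (hobs : ∀ x : X, δ * ‖S.op T x‖ ^ 2 ≤
      ∫ t in (0 : ℝ)..T, RCLike.re (inner 𝕜 (projX A μ W (B (S.op t x))) (S.op t x))) :
    ∃ ρ₁ : ℝ, 0 < ρ₁ ∧ ∀ ρ : ℝ, 0 < ρ → ρ < ρ₁ →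
      ∃ U : C0Semigroup 𝕜 X,
        U.IsGeneratedBy (part A μ (extrapGen A μ - (ρ : 𝕜) • B)) ∧
        (∀ (x₀ : X) (x : ℝ → X), IsMildSolution S A μ B ρ x₀ x ↔
          ∀ t : ℝ, 0 ≤ t → x t = U.op t x₀) ∧
        ∃ K σ : ℝ, 0 < K ∧ 0 < σ ∧ ∀ (t : ℝ) (x₀ : X), 0 ≤ t →
          ‖U.op t x₀‖ ≤ K * Real.exp (-σ * t) * ‖x₀‖ := by
  let _ : NormedSpace ℝ X := NormedSpace.restrictScalars ℝ 𝕜 X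
  have : IsScalarTower ℝ 𝕜 X := ⟨fun r c z => by
    rw [Algebra.smul_def, mul_smul]
    rfl⟩
  obtain ⟨ρ₀, hρ₀, hdec⟩ := hW
  -- The `X`-component of `B` does not depend on the gain: any one will do.
  obtain ⟨C, hC⟩ := (hdec (ρ₀ / 2) (half_pos hρ₀) (half_lt_self hρ₀)).exists_projX_eq hμ
    (half_pos hρ₀)
  obtain ⟨N, H⟩ := hB.exists_isBoundedControl hcontr hA hμ hp
  have hdense := hA.dense_domain hcontr.continuousOn_orbit
  obtain ⟨ρ₁, hρ₁, hstab⟩ := H.exists_exponentially_stable (C := C)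
    (tendsto_resolvent_orbit hA hμ) hρ₀ (fun ρ hρ hlt x y hxy => by
      rw [hC]
      exact (hdec ρ hρ hlt).re_inner_le hμ hρ ((mem_graph_part_iff hμ hdense ρ x y).2 hxy))
    hT hδ fun x => by simpa only [hC] using hobs x
  refine ⟨ρ₁, hρ₁, fun ρ hρ hlt => ?_⟩
  obtain ⟨hρN, hexp⟩ := hstab ρ hρ hlt
  obtain ⟨U, hU⟩ := H.exists_isPerturbedSemigroup hρ.le hρN
  exact ⟨U, hU.isGeneratedBy_part hA hμ H hρ.le hρN,
    hU.isMildSolution_iff hA hμ H hρ.le hρN, hexp U hU⟩
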